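/- **Definitions.** A *Markov number* is a member of a triple of positive integers $(x,y,z)$ with $x^2+y^2+z^2=3xyz$. For coprime integers $0<p<q$ the number $m_{p/q}$ is defined as follows. Consider the torus $\mathbb R^2/\mathbb Z^2$ with one puncture at the class of $(0,0)$; its arcs are given by the primitive vectors of $\mathbb Z^2$ up to sign, and its triangulations by triples of arcs whose vectors, with suitable signs, are a basis $u,v$ of $\mathbb Z^2$ and $-(u+v)$. The initial seed consists of the arcs $(1,0)$, $(0,1)$, $(1,-1)$ with cluster variables $x_1,x_2,x_3$. A mutation replaces one arc of the triangulation, the diagonal $\pm(u+v)$ of the parallelogram on the other two arcs $u,v$, by the other diagonal $\pm(u-v)$, and its cluster variable $x$ by $x'$ with $x'x=x_u^2+x_v^2$. Then $m_{p/q}$ is the value at $x_1=x_2=x_3=1$ of the cluster variable belonging to the line segment from $(0,0)$ to $(q,p)$. For $1\le i\le p$ let $\nu_i=s_i-s_{i-1}$, where $s_i=\lfloor iq/p\rfloor$ for $0\le i<p$ and $s_p=q-1$. The continued fraction $[a_1,a_2,\dots,a_k]$ means $a_1+\cfrac{1}{a_2+\cfrac{1}{\ddots+\cfrac1{a_k}}}$,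 and its numerator is that of this rational number in lowest terms. **Theorem.** For all coprime integers $0<p<q$ the number $m_{p/q}$ is well defined and is a Markov number, and every Markov number other than $1$ and $2$ is equal to $m_{p/q}$ for some such $p,q$. The number $m_{p/q}$ is the numerator of the continued fraction $$F(p/q)=[2,\underbrace{1,\dots,1}_{2(\nu_1-1)},2,2,\underbrace{1,\dots,1}_{2(\nu_2-1)},2,2,\dots,2,2,\underbrace{1,\dots,1}_{2(\nu_p-1)},2],$$ which is palindromic of even length, $F(p/q)=[a_n,\dots,a_2,a_1,a_1,a_2,\dots,a_n]$, and: 1. $a_i\in\{1,2\}$ for all $i$, and $a_n=2$. 2. If $p+1=q$, then $n=p$ and $a_i=2$ for all $i$. 3. If $p+1<q$, then $\frac{c-1}{c}<\frac pq<\frac{c}{c+1}$ for a unique positive integer $c$, and - (a) there are at most $p+1$ maximal subsequences of consecutive $2$s in $F(p/q)$; the first and the last one have odd length $2c-1$, and each of the others has even length $2c-2$ or $2c$; - (b) there are at most $p$ maximal subsequences of consecutive $1$s in $F(p/q)$; each of them has even length $2(\nu_i-1)$ for some $i$, and $|\nu_i-\nu_j|\le 1$ for all $i,j$. Moreover, the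 map $p/q\mapsto F(p/q)$ from the rational numbers strictly between $0$ and $1$ to palindromic continued fractions (as finite sequences) is injective. -/

import Mathlib

open scoped BigOperators

/-- A Markov number: a member of a triple of positive integers solving `x² + y² + z² = 3xyz`
(the equation is symmetric, so the member may be taken to be the first one). -/
def IsMarkovNumber (m : ℕ) : Prop :=
  ∃ y z : ℕ, 0 < m ∧ 0 < y ∧ 0 < z ∧ m ^ 2 + y ^ 2 + z ^ 2 = 3 * m * y * z

/-- A labelled seed of the once-punctured torus, with cluster variables in a field `K`.
The torus is `ℝ² / ℤ²` with puncture the class of `(0,0)`; its arcs are the images of the segments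
from `(0,0)` to primitive vectors `(x, y)`, so an arc is a primitive vector up to sign.
An ideal triangulation consists of three arcs; we choose the signs so that the three vectors are
the oriented sides of a triangle, that is, so that they add up to `0`. -/
@[ext]
structure TorusSeed (K : Type*) where
  /-- the three arcs of the triangulation, as vectors `(x, y)` up to a common sign -/
  arc : Fin 3 → ℤ × ℤ
  /-- the three cluster variables -/
  var : Fin 3 → K

namespace TorusSeed

/-- The initial seed: `x₁` and `x₂` belong to the standard basis vectors, `x₃` to the line segment
between `(1,0)` and `(0,1)`. -/
def initial {K : Type*} (x : Fin 3 → K) : TorusSeed K where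
  arc := ![(1, 0), (0, -1), (-1, 1)]
  var := x

/-- Mutation in direction `k`. With `i`, `j` the other two indices, the arc `k`, which is the
diagonal `±(aᵢ + aⱼ)` of the parallelogram with sides `aᵢ`, `aⱼ`, is flipped to the other diagonal
`±(aᵢ - aⱼ)` (the sign of `aⱼ` is changed so that the new vectors again add up to `0`), and the
cluster variable `k` is replaced according to the exchange relation `xₖ' xₖ = xᵢ² + xⱼ²`. -/
def mutate {K : Type*} [Field K] (S : TorusSeed K) (k : Fin 3) : TorusSeed K where
  arc := fun l =>
    if l = k then S.arc (k + 2) - S.arc (k + 1)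
    else if l = k + 1 then S.arc (k + 1)
    else - S.arc (k + 2)
  var := fun l =>
    if l = k then (S.var (k + 1) ^ 2 + S.var (k + 2) ^ 2) / S.var k else S.var l

/-- The seeds that are obtained from the initial seed by finitely many mutations. -/
inductive Reachable {K : Type*} [Field K] (x : Fin 3 → K) : TorusSeed K → Prop
  | init : Reachable x (initial x)
  | step (S : TorusSeed K) (k : Fin 3) : Reachable x S → Reachable x (S.mutate k)

end TorusSeed

/-- The field of rational functions in the three initial cluster variables `x₁, x₂, x₃`. -/
abbrev ClusterField : Type := FractionRing (MvPolynomial (Fin 3) ℚ)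

/-- `X` is the cluster variable of the once-punctured torus that is represented by the line segment
from `(0,0)` to `(q,p)`. -/
def IsClusterVariable (p q : ℕ) (X : ClusterField) : Prop :=
  ∃ S : TorusSeed ClusterField,
    TorusSeed.Reachable
      (fun i => algebraMap (MvPolynomial (Fin 3) ℚ) ClusterField (MvPolynomial.X i)) S ∧
    ∃ i : Fin 3, (S.arc i = ((q : ℤ), (p : ℤ)) ∨ S.arc i = (-(q : ℤ), -(p : ℤ))) ∧ S.var i = X

/-- The rational function `X` takes the value `t` when `x₁ = x₂ = x₃ = 1`. -/
def HasValueAtOne (X : ClusterField) (t : ℚ) : Prop :=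
  ∃ N D : MvPolynomial (Fin 3) ℚ, MvPolynomial.eval (fun _ => (1 : ℚ)) D ≠ 0 ∧
    X = algebraMap (MvPolynomial (Fin 3) ℚ) ClusterField N /
      algebraMap (MvPolynomial (Fin 3) ℚ) ClusterField D ∧
    t = MvPolynomial.eval (fun _ => (1 : ℚ)) N / MvPolynomial.eval (fun _ => (1 : ℚ)) D

/-- `m` is the Markov number `m_{p/q}`: the cluster variable of the line segment from `(0,0)` to
`(q,p)` becomes `m` when the three initial cluster variables are set equal to `1`. -/
def IsMarkovNumberOfSlope (p q m : ℕ) : Prop :=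
  ∃ X : ClusterField, IsClusterVariable p q X ∧ HasValueAtOne X (m : ℚ)

/-- The value of the continued fraction `[a₁, a₂, …, aₙ] = a₁ + 1 / (a₂ + 1 / (⋯ + 1 / aₙ))`
(and `0` for the empty sequence, which is not a continued fraction). -/
def cfValue : List ℕ → ℚ
  | [] => 0
  | [a] => (a : ℚ)
  | a :: b :: l => (a : ℚ) + 1 / cfValue (b :: l)

/-- `ν₁ + ⋯ + νᵢ`, the number of vertical grid edges that the line segment from `(0,0)` to `(q,p)`
crosses below height `i`: this is `⌊i q / p⌋` for `i < p` and `q - 1` for `i = p`. -/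
def crossingSum (p q i : ℕ) : ℕ := if i = p then q - 1 else i * q / p

/-- `νᵢ` for `1 ≤ i ≤ p`: the number of vertical grid edges that the line segment from `(0,0)` to
`(q,p)` crosses between heights `i - 1` and `i`. -/
def crossing (p q i : ℕ) : ℕ := crossingSum p q i - crossingSum p q (i - 1)

/-- The sequence
`2, 1, …, 1, 2, 2, 1, …, 1, 2, 2, …, 2, 2, 1, …, 1, 2`
with `p` blocks of `1`s, the `i`-th of them of (possibly zero) length `2 (νᵢ - 1)`. -/
def markovCF (p q : ℕ) : List ℕ :=
  [2] ++ List.intercalate [2, 2]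
    ((List.range p).map fun i => List.replicate (2 * (crossing p q (i + 1) - 1)) 1) ++ [2]

/-- The lengths of the maximal constant subsequences of consecutive entries `a` of a list, from
left to right. -/
def runLengths (a : ℕ) (L : List ℕ) : List ℕ :=
  ((L.splitBy (fun x y => x == y)).filter (fun R => R.head? == some a)).map List.length

/-! Read the segment from `(0,0)` to `(q,p)` as a word in its crossings with horizontal and vertical
grid edges, and multiply matrices of determinant one along this word (`slopeMat`). For Farey
neighbours `u`, `v` the word of `u + v` is the concatenation of the words of `u` and `v`, so `M(u+v)
= M(u) M(v)` (`slopeMat_add`). Cayley–Hamilton gives `X(XY) = tr(X) XY - Y`. The trace and the lower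
left entry obey this same linear recursion, so the trace stays three times the entry
(`trace_slopeMat`), and the entries `m` satisfy `m(2u+v) + m(v) = 3 m(u) m(u+v)`.

A rotation of order three extends `m` to all vectors, and `m(u+v) + m(u-v) = 3 m(u) m(v)` then holds
for every basis (`vectorNumber_exchange`). Given the Markov equation for the old triangle, this sum
relation is equivalent to the exchange relation `z z' = x² + y²`. Induction along mutations
therefore shows that the cluster variables of every seed take the values `m` at `1`, and that these
values form a Markov triple. Farey induction realises every slope by an arc. Conversely, replacing
the largest member of a Markov triple by the other root of its quadratic retraces the Farey tree, so
every Markov number is reached.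

For the continued fraction, let `C` be the matrix of a partial quotient `2`. Then `hMat * vMat =
C²`, and two partial quotients `1` give `vMat`. Hence the matrix of the sequence is `slopeMat` up to
factors at the ends, and the numerators agree. The palindrome is the central symmetry of the
segment. Injectivity follows by counting: there are `2p` entries `2` among `2(q-1)` entries. The run
structure reflects how evenly the crossings are distributed: either every row is crossed at least
twice, and then `c = 1`, or every row is crossed once or twice, and the doubly crossed rows sit at
the ceilings of `m p / (q-p)`. -/

/-! ### Farey pairs and matrix products along Christoffel words. -/

/-- Euclidean descent: in a unimodular pair of the closed quadrant other than the two unit vectors,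
one vector dominates the other coordinatewise, and subtracting keeps the pair unimodular. -/
theorem farey_induction {P : ℕ → ℕ → ℕ → ℕ → Prop} (base : P 0 1 1 0)
    (left : ∀ a b c d, b * c = d * a + 1 → P a b c d → P a b (a + c) (b + d))
    (right : ∀ a b c d, b * c = d * a + 1 → P a b c d → P (a + c) (b + d) c d) :
    ∀ a b c d, b * c = d * a + 1 → P a b c d := by
  suffices H : ∀ n a b c d, a + b + c + d = n → b * c = d * a + 1 → P a b c d from
    fun a b c d h => H _ a b c d rfl h
  intro n
  induction n using Nat.strong_induction_on with
  | _ n ih =>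
  intro a b c d hn h
  have hb : 0 < b := by rcases Nat.eq_zero_or_pos b with rfl | h'; · simp at h
                        · exact h'
  have hc : 0 < c := by rcases Nat.eq_zero_or_pos c with rfl | h'; · simp at h
                        · exact h'
  by_cases h1 : a ≤ c ∧ b ≤ d
  · obtain ⟨c', rfl⟩ := Nat.exists_eq_add_of_le h1.1
    obtain ⟨d', rfl⟩ := Nat.exists_eq_add_of_le h1.2
    have h' : b * c' = d' * a + 1 := by nlinarith
    exact left a b c' d' h' (ih _ (by omega) a b c' d' rfl h')
  by_cases h2 : c ≤ a ∧ d ≤ b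
  · obtain ⟨a', rfl⟩ := Nat.exists_eq_add_of_le' h2.1
    obtain ⟨b', rfl⟩ := Nat.exists_eq_add_of_le' h2.2
    have h' : b' * c = d * a' + 1 := by nlinarith
    exact right a' b' c d h' (ih _ (by omega) a' b' c d rfl h')
  by_cases h3 : c < a
  · have : b < d := by omega
    nlinarith
  · have hac : a < c := by
      rcases Nat.lt_or_ge a c with h' | h'
      · exact h'
      · exfalso; have : a = c := by omega
        omega
    have hdb : d < b := by omega
    have h4 : a = 0 ∧ d = 0 := by
      constructor <;> nlinarith
    obtain ⟨rfl, rfl⟩ := h4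
    simp at h
    obtain ⟨rfl, rfl⟩ := h
    exact base

open Matrix

/-- The matrix of a crossing with a vertical grid edge. -/
def vMat : Matrix (Fin 2) (Fin 2) ℤ := !![2, 1; 1, 1]
/-- The matrix of a crossing with a horizontal grid edge. -/
def hMat : Matrix (Fin 2) (Fin 2) ℤ := !![3, -1; 1, 0]

/-- The product of the matrices `vMat` and `hMat` along the Christoffel word of `(q, p)`. -/
def slopeMat (q p : ℕ) : Matrix (Fin 2) (Fin 2) ℤ :=
  if p = 0 then vMat
  else ((List.range p).map fun i => hMat * vMat ^ ((i + 1) * q / p - i * q / p)).prod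

theorem slopeMat_zero_one : slopeMat 0 1 = hMat := by simp [slopeMat]

theorem slopeMat_one_zero : slopeMat 1 0 = vMat := by simp [slopeMat]

/-- The mediant exceeds `a / b` by `1 / (b (b + d))`. Multiplied by `i ≤ b` this is less than `1 /
b`, too little to carry a multiple of `1 / b` past an integer. -/
theorem floor_mediant_left {a b c d : ℕ} (hb : 0 < b) (hd : 0 < d) (h : b * c = d * a + 1)
    {i : ℕ} (hi : i ≤ b) : i * (a + c) / (b + d) = i * a / b := by
  have h1 : i * a / b * b ≤ i * a := Nat.div_mul_le_self _ _
  have h2 : i * a < (i * a / b + 1) * b := Nat.lt_mul_of_div_lt (Nat.lt_succ_self _) hb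
  generalize i * a / b = k at h1 h2
  apply Nat.div_eq_of_lt_le
  · have h3 : k * d ≤ i * c := by
      refine Nat.le_of_mul_le_mul_left ?_ hb
      calc b * (k * d) = d * (k * b) := by ring
        _ ≤ d * (i * a) := Nat.mul_le_mul_left _ h1
        _ ≤ i * (d * a + 1) := by nlinarith
        _ = b * (i * c) := by rw [← h]; ring
    nlinarith
  · zify at *
    obtain ⟨e, he⟩ : ∃ e : ℤ, (k + 1) * b = i * a + e := ⟨(k + 1) * b - i * a, by ring⟩
    have he1 : 1 ≤ e := by linarith
    have h4 : (b : ℤ) * (e + (k + 1) * d - i * c) = b * e + d * e - i := by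
      linear_combination (d : ℤ) * he - (i : ℤ) * h
    have h5 : 0 < (b : ℤ) * (e + (k + 1) * d - i * c) := by rw [h4]; nlinarith
    have h6 := pos_of_mul_pos_right h5 hb.le
    linarith

/-- Before taking floors the left side exceeds `a + j c / d` by `(d - j) / (d (b + d))`, which lies
between `0` and `1 / d`, the latter excluded. -/
theorem floor_mediant_right {a b c d : ℕ} (hb : 0 < b) (hd : 0 < d) (h : b * c = d * a + 1)
    {j : ℕ} (hj : j ≤ d) : (b + j) * (a + c) / (b + d) = a + j * c / d := by
  have h1 : j * c / d * d ≤ j * c := Nat.div_mul_le_self _ _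
  have h2 : j * c < (j * c / d + 1) * d := Nat.lt_mul_of_div_lt (Nat.lt_succ_self _) hd
  generalize j * c / d = k at h1 h2
  apply Nat.div_eq_of_lt_le
  · zify at *
    obtain ⟨e, he⟩ : ∃ e : ℤ, (j * c : ℤ) = k * d + e := ⟨j * c - k * d, by ring⟩
    have he0 : 0 ≤ e := by linarith
    have h4 : (d : ℤ) * (1 + j * a - k * b + e) = d + b * e - j + d * e := by
      linear_combination (b : ℤ) * he - (j : ℤ) * h
    have h5 : 0 ≤ (d : ℤ) * (1 + j * a - k * b + e) := by
      rw [h4]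
      have := mul_nonneg hb.le he0
      have := mul_nonneg hd.le he0
      linarith
    have h6 := nonneg_of_mul_nonneg_right h5 hd
    linarith
  · zify at *
    obtain ⟨e, he⟩ : ∃ e : ℤ, (k + 1) * d = j * c + e := ⟨(k + 1) * d - j * c, by ring⟩
    have he1 : 1 ≤ e := by linarith
    have h4 : (d : ℤ) * ((k + 1) * b - j * a + e - 1) = b * e + j + d * (e - 1) := by
      linear_combination (b : ℤ) * he + (j : ℤ) * h
    have h5 : 0 < (d : ℤ) * ((k + 1) * b - j * a + e - 1) := by
      rw [h4]
      have := mul_pos hb (show (0 : ℤ) < e by linarith)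
      have := mul_nonneg hd.le (show (0 : ℤ) ≤ e - 1 by linarith)
      have : (0 : ℤ) ≤ j := by positivity
      linarith
    have h6 := pos_of_mul_pos_right h5 hd.le
    linarith

/-- The standard factorization of Christoffel words: rows below height `b` are crossed as by `(a,
b)`, the remaining ones as by `(c, d)`. -/
theorem slopeMat_add {a b c d : ℕ} (h : b * c = d * a + 1) :
    slopeMat (a + c) (b + d) = slopeMat a b * slopeMat c d := by
  have hb : 0 < b := by rcases Nat.eq_zero_or_pos b with rfl | h'; · simp at h
                        · exact h'
  rcases Nat.eq_zero_or_pos d with rfl | hd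
  · have : b = 1 ∧ c = 1 := by simpa using h
    obtain ⟨rfl, rfl⟩ := this
    simp [slopeMat, pow_succ, mul_assoc]
  · rw [slopeMat, slopeMat, slopeMat, if_neg (by omega), if_neg (by omega), if_neg (by omega),
      List.range_add, List.map_append, List.prod_append, List.map_map]
    congr 2
    · apply List.map_congr_left
      intro i hi
      rw [List.mem_range] at hi
      rw [floor_mediant_left hb hd h hi.le, floor_mediant_left hb hd h (Nat.succ_le_of_lt hi)]
    · apply List.map_congr_left
      intro i hi
      rw [List.mem_range] at hi
      simp only [Function.comp]
      rw [floor_mediant_right hb hd h hi.le, add_assoc b i 1,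
        floor_mediant_right hb hd h (Nat.succ_le_of_lt hi), Nat.add_sub_add_left]

theorem det_vMat : vMat.det = 1 := by simp [vMat, Matrix.det_fin_two]
theorem det_hMat : hMat.det = 1 := by simp [hMat, Matrix.det_fin_two]

theorem det_slopeMat (q p : ℕ) : (slopeMat q p).det = 1 := by
  unfold slopeMat
  split_ifs
  · exact det_vMat
  · generalize List.range p = l
    induction l with
    | nil => simp
    | cons i l ih => simp [ih, det_vMat, det_hMat]

theorem mul_self_of_det_eq_one {X : Matrix (Fin 2) (Fin 2) ℤ} (h : X.det = 1) :
    X * X = X.trace • X - 1 := by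
  rw [Matrix.det_fin_two] at h
  ext i j
  rw [Matrix.sub_apply, Matrix.smul_apply, Matrix.mul_apply, Fin.sum_univ_two, smul_eq_mul,
    Matrix.trace_fin_two, Matrix.one_apply]
  fin_cases i <;> fin_cases j <;> simp <;> linarith

/-- All three members of the triple `X`, `Y`, `XY` are carried along, because `X(XY) = tr(X) XY - Y`
and `(XY)Y = tr(Y) XY - X` express the new product through two of them. -/
theorem trace_slopeMat {a b c d : ℕ} (h : b * c = d * a + 1) :
    (slopeMat a b).trace = 3 * slopeMat a b 1 0 ∧ (slopeMat c d).trace = 3 * slopeMat c d 1 0 ∧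
      (slopeMat (a + c) (b + d)).trace = 3 * slopeMat (a + c) (b + d) 1 0 := by
  refine farey_induction (P := fun a b c d =>
    (slopeMat a b).trace = 3 * slopeMat a b 1 0 ∧ (slopeMat c d).trace = 3 * slopeMat c d 1 0 ∧
      (slopeMat (a + c) (b + d)).trace = 3 * slopeMat (a + c) (b + d) 1 0) ?_ ?_ ?_ a b c d h
  · rw [slopeMat_add (a := 0) (b := 1) (c := 1) (d := 0) rfl, slopeMat_zero_one, slopeMat_one_zero]
    simp [vMat, hMat, Matrix.trace_fin_two, Matrix.mul_apply, Fin.sum_univ_two]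
  · rintro a b c d h ⟨h1, h2, h3⟩
    refine ⟨h1, h3, ?_⟩
    rw [slopeMat_add (c := a + c) (d := b + d) (by nlinarith), slopeMat_add h, ← mul_assoc,
      mul_self_of_det_eq_one (det_slopeMat a b), sub_mul, one_mul, smul_mul_assoc,
      ← slopeMat_add h, trace_sub, trace_smul, h3, h2, Matrix.sub_apply, Matrix.smul_apply]
    simp only [smul_eq_mul]; ring
  · rintro a b c d h ⟨h1, h2, h3⟩
    refine ⟨h3, h2, ?_⟩
    rw [slopeMat_add (a := a + c) (b := b + d) (by nlinarith), slopeMat_add h, mul_assoc,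
      mul_self_of_det_eq_one (det_slopeMat c d), mul_sub, mul_one, mul_smul_comm,
      ← slopeMat_add h, trace_sub, trace_smul, h3, h1, Matrix.sub_apply, Matrix.smul_apply]
    simp only [smul_eq_mul]; ring

/-! ### Markov numbers of lattice vectors and their exchange relation. -/

/-- The Markov number of a primitive vector of the closed first quadrant. -/
def slopeNumber (q p : ℕ) : ℤ := if q = 0 ∨ p = 0 then 1 else slopeMat q p 1 0

theorem slopeNumber_eq {q p : ℕ} (h : Nat.Coprime q p) : slopeNumber q p = slopeMat q p 1 0 := by
  unfold slopeNumber
  split_ifs with h0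
  · rcases h0 with rfl | rfl
    · have : p = 1 := by simpa using h
      subst this; simp [slopeMat_zero_one, hMat]
    · simp [slopeMat, vMat]
  · rfl

theorem coprime_of_farey {a b c d : ℕ} (h : b * c = d * a + 1) :
    Nat.Coprime a b ∧ Nat.Coprime c d ∧ Nat.Coprime (a + c) (b + d) := by
  have key : ∀ a b c d : ℕ, b * c = d * a + 1 → Nat.Coprime a b ∧ Nat.Coprime c d := by
    intro a b c d h
    constructor
    · apply Nat.Coprime.of_dvd_right (Dvd.intro c rfl : b ∣ b * c)
      rw [h]; simp
    · apply Nat.Coprime.of_dvd_left (Dvd.intro_left b rfl : c ∣ b * c)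
      rw [h]; simp
  exact ⟨(key _ _ _ _ h).1, (key _ _ _ _ h).2,
    (key a b (a + c) (b + d) (by nlinarith)).2⟩

theorem slopeNumber_add_left {a b c d : ℕ} (h : b * c = d * a + 1) :
    slopeNumber (a + (a + c)) (b + (b + d)) + slopeNumber c d =
      3 * slopeNumber a b * slopeNumber (a + c) (b + d) := by
  have h' : b * (a + c) = (b + d) * a + 1 := by nlinarith
  rw [slopeNumber_eq (coprime_of_farey h').2.2, slopeNumber_eq (coprime_of_farey h).2.1,
    slopeNumber_eq (coprime_of_farey h).1, slopeNumber_eq (coprime_of_farey h).2.2,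
    slopeMat_add h', slopeMat_add h, ← mul_assoc,
    mul_self_of_det_eq_one (det_slopeMat a b), sub_mul, one_mul, smul_mul_assoc,
    (trace_slopeMat h).1, Matrix.sub_apply, Matrix.smul_apply]
  simp only [smul_eq_mul]; ring

theorem slopeNumber_add_right {a b c d : ℕ} (h : b * c = d * a + 1) :
    slopeNumber (a + c + c) (b + d + d) + slopeNumber a b =
      3 * slopeNumber c d * slopeNumber (a + c) (b + d) := by
  have h' : (b + d) * c = d * (a + c) + 1 := by nlinarith
  rw [slopeNumber_eq (coprime_of_farey h').2.2, slopeNumber_eq (coprime_of_farey h).2.1,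
    slopeNumber_eq (coprime_of_farey h).1, slopeNumber_eq (coprime_of_farey h).2.2,
    slopeMat_add h', slopeMat_add h, mul_assoc,
    mul_self_of_det_eq_one (det_slopeMat c d), mul_sub, mul_one, mul_smul_comm,
    (trace_slopeMat h).2.1, Matrix.sub_apply, Matrix.smul_apply]
  simp only [smul_eq_mul]; ring

/-- The Markov number of a primitive vector of `ℤ²`, defined by the rotational symmetry of order `3`
of the torus that permutes the arcs `(1, 0)`, `(0, 1)`, `(1, -1)`. -/
def vectorNumber (x y : ℤ) : ℤ :=
  if 0 ≤ x * y then slopeNumber x.natAbs y.natAbs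
  else if 0 ≤ y * (-x - y) then slopeNumber y.natAbs (-x - y).natAbs
  else slopeNumber (-x - y).natAbs x.natAbs

theorem slopeNumber_zero_left (n : ℕ) : slopeNumber 0 n = 1 := by simp [slopeNumber]
theorem slopeNumber_zero_right (n : ℕ) : slopeNumber n 0 = 1 := by simp [slopeNumber]

theorem vectorNumber_natCast (q p : ℕ) : vectorNumber q p = slopeNumber q p := by
  rw [vectorNumber, if_pos (by positivity)]; simp

theorem vectorNumber_neg (x y : ℤ) : vectorNumber (-x) (-y) = vectorNumber x y := by
  unfold vectorNumber
  rw [show -x * -y = x * y by ring, show -y * (- -x - -y) = y * (-x - y) by ring,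
    show - -x - -y = -(-x - y) by ring]
  simp only [Int.natAbs_neg]

/-- With `z = -x - y` the rotation permutes `x`, `y`, `z` cyclically, and the three cases of the
definition are closed double sectors covering the plane. Two of them meet only where a coordinate
vanishes, and there both formulas give `1`, even for vectors that are not primitive. -/
theorem vectorNumber_rotate (x y : ℤ) : vectorNumber y (-x - y) = vectorNumber x y := by
  have hz : ∃ z, z = -x - y := ⟨_, rfl⟩
  obtain ⟨z, hz⟩ := hz
  unfold vectorNumber
  rw [← hz]
  have h3 : 0 ≤ x * y ∨ 0 ≤ y * z ∨ 0 ≤ z * x := by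
    by_contra! h
    obtain ⟨h1, h2, h3⟩ := h
    have := mul_pos_of_neg_of_neg h1 h2
    nlinarith [sq_nonneg y]
  rw [show -y - z = x by rw [hz]; ring]
  by_cases h1 : 0 ≤ y * z <;> by_cases h2 : 0 ≤ x * y
  · have hy : y = 0 := by
      have : y * y ≤ 0 := by rw [hz] at h1; nlinarith
      exact mul_self_eq_zero.1 (le_antisymm this (mul_self_nonneg y))
    simp [hy, slopeNumber_zero_left, slopeNumber_zero_right]
  · rw [if_pos h1, if_neg h2, if_pos h1]
  · rw [if_neg h1, if_pos h2]
    split_ifs with h4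
    · have hx : x = 0 := by
        have : x * x ≤ 0 := by rw [hz] at h4; nlinarith
        exact mul_self_eq_zero.1 (le_antisymm this (mul_self_nonneg x))
      simp [hx, slopeNumber_zero_left, slopeNumber_zero_right]
    · rfl
  · rw [if_neg h1, if_neg h2, if_neg h1, if_pos (by tauto)]

/-- If `c` and `d` have strictly opposite signs, the determinant is up to sign a sum of two
nonnegative terms. Such a sum equals `1` only if `(a, b)` is a unit vector. -/
theorem basis_cases {a b c d : ℤ} (h : a * d - b * c = 1 ∨ a * d - b * c = -1) (ha : 0 ≤ a)
    (hb : 0 ≤ b) : (0 ≤ c ∧ 0 ≤ d) ∨ (c ≤ 0 ∧ d ≤ 0) ∨ (a = 0 ∧ b = 1 ∧ c = 1 ∧ d ≤ -1) ∨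
      (a = 0 ∧ b = 1 ∧ c = -1 ∧ 1 ≤ d) ∨ (a = 1 ∧ b = 0 ∧ d = 1 ∧ c ≤ -1) ∨
      (a = 1 ∧ b = 0 ∧ d = -1 ∧ 1 ≤ c) := by
  by_cases hc : c = 0
  · subst hc; omega
  by_cases hd : d = 0
  · subst hd; omega
  have aux : ∀ m n : ℤ, 1 ≤ m → 1 ≤ n → a * n + b * m = 1 →
      (a = 0 ∧ b = 1 ∧ m = 1) ∨ (a = 1 ∧ b = 0 ∧ n = 1) := by
    intro m n hm hn h
    rcases ha.eq_or_lt with rfl | ha'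
    · left
      have hb' : b ∣ 1 := ⟨m, by linarith⟩
      have : b = 1 := Int.eq_one_of_dvd_one hb hb'
      subst this; simpa using h
    rcases hb.eq_or_lt with rfl | hb'
    · right
      have hb' : a ∣ 1 := ⟨n, by linarith⟩
      have : a = 1 := Int.eq_one_of_dvd_one ha hb'
      subst this; simpa using h
    nlinarith
  rcases lt_or_gt_of_ne hc with hc | hc <;> rcases lt_or_gt_of_ne hd with hd | hd
  · right; left; omega
  · have h1 : a * d + b * (-c) = 1 := by
      rcases h with h | h
      · linarith
      · nlinarith
    rcases aux (-c) d (by omega) (by omega) h1 with h | h <;> omega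
  · have h1 : a * (-d) + b * c = 1 := by
      rcases h with h | h
      · nlinarith
      · linarith
    rcases aux c (-d) (by omega) (by omega) h1 with h | h <;> omega
  · left; omega

theorem vectorNumber_exchange_nat {a b c d : ℕ} (h : b * c = d * a + 1) :
    vectorNumber (a + c) (b + d) + vectorNumber (a - c) (b - d) =
      3 * vectorNumber a b * vectorNumber c d := by
  refine farey_induction (P := fun a b c d : ℕ =>
    vectorNumber (a + c) (b + d) + vectorNumber (a - c) (b - d) =
      3 * vectorNumber a b * vectorNumber c d) ?_ ?_ ?_ a b c d h
  · simp [vectorNumber, slopeNumber, slopeMat, Matrix.mul_apply, vMat, hMat, Fin.sum_univ_two]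
  · rintro a b c d h -
    have := slopeNumber_add_left h
    simp only [← vectorNumber_natCast] at this
    push_cast at this ⊢
    rw [show (a : ℤ) - (a + c) = - c by ring, show (b : ℤ) - (b + d) = - d by ring,
      vectorNumber_neg]
    exact this
  · rintro a b c d h -
    have := slopeNumber_add_right h
    simp only [← vectorNumber_natCast] at this
    push_cast at this ⊢
    rw [show (a : ℤ) + c - c = a by ring, show (b : ℤ) + d - d = b by ring, this]
    ring

/-- The relation is invariant under swapping the two vectors, changing the sign of either, and
rotating both. These symmetries move every basis into the closed first quadrant, where the Farey
recursion applies. -/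
theorem vectorNumber_exchange {a b c d : ℤ} (h : a * d - b * c = 1 ∨ a * d - b * c = -1) :
    vectorNumber (a + c) (b + d) + vectorNumber (a - c) (b - d) =
      3 * vectorNumber a b * vectorNumber c d := by
  let E (a b c d : ℤ) : Prop := vectorNumber (a + c) (b + d) + vectorNumber (a - c) (b - d) =
      3 * vectorNumber a b * vectorNumber c d
  have Esymm : ∀ a b c d, E a b c d → E c d a b := by
    intro a b c d h
    simp only [E] at h ⊢
    rw [← vectorNumber_neg (c - a)]
    ring_nf at h ⊢
    exact h
  have Eneg : ∀ a b c d, E a b (-c) (-d) → E a b c d := by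
    intro a b c d h
    simp only [E, vectorNumber_neg] at h ⊢
    rw [← h]; ring_nf
  have Eneg' : ∀ a b c d, E (-a) (-b) c d → E a b c d := fun a b c d h =>
    Esymm _ _ _ _ (Eneg _ _ _ _ (Esymm _ _ _ _ h))
  have Erot : ∀ a b c d, E b (-a - b) d (-c - d) → E a b c d := by
    intro a b c d h
    simp only [E] at h ⊢
    rw [vectorNumber_rotate a b, vectorNumber_rotate c d] at h
    rw [← h, ← vectorNumber_rotate (a + c), ← vectorNumber_rotate (a - c)]
    ring_nf
  have Enn : ∀ a b c d : ℤ, (a * d - b * c = 1 ∨ a * d - b * c = -1) → 0 ≤ a → 0 ≤ b → 0 ≤ c →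
      0 ≤ d → E a b c d := by
    intro a b c d h ha hb hc hd
    lift a to ℕ using ha
    lift b to ℕ using hb
    lift c to ℕ using hc
    lift d to ℕ using hd
    rcases h with h | h
    · exact Esymm _ _ _ _ (vectorNumber_exchange_nat (by zify; linarith))
    · exact vectorNumber_exchange_nat (by zify; linarith)
  have Epos : ∀ a b c d : ℤ, (a * d - b * c = 1 ∨ a * d - b * c = -1) → 0 ≤ a → 0 ≤ b →
      E a b c d := by
    intro a b c d h ha hb
    rcases basis_cases h ha hb with h1 | h1 | ⟨rfl, rfl, rfl, h1⟩ | ⟨rfl, rfl, rfl, h1⟩ |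
      ⟨rfl, rfl, rfl, h1⟩ | ⟨rfl, rfl, rfl, h1⟩
    · exact Enn _ _ _ _ h ha hb h1.1 h1.2
    · exact Eneg _ _ _ _ (Enn _ _ _ _ (by ring_nf at h ⊢; omega) ha hb (by omega) (by omega))
    -- Two rotations and a sign carry `(0, 1)`, `(1, d)` to `(1, 0)`, `(-1 - d, 1)`, which lie in
    -- the quadrant because `d ≤ -1`. The other exceptional bases are treated in the same way.
    · exact Erot _ _ _ _ (Erot _ _ _ _ (Eneg' _ _ _ _
        (Enn _ _ _ _ (by left; ring1) (by omega) (by omega) (by omega) (by omega))))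
    · exact Eneg _ _ _ _ (Erot _ _ _ _ (Erot _ _ _ _ (Eneg' _ _ _ _
        (Enn _ _ _ _ (by left; ring1) (by omega) (by omega) (by omega) (by omega)))))
    · exact Erot _ _ _ _ (Eneg' _ _ _ _
        (Enn _ _ _ _ (by right; ring1) (by omega) (by omega) (by omega) (by omega)))
    · exact Eneg _ _ _ _ (Erot _ _ _ _ (Eneg' _ _ _ _
        (Enn _ _ _ _ (by right; ring1) (by omega) (by omega) (by omega) (by omega))))
  have Eprod : ∀ a b c d : ℤ, (a * d - b * c = 1 ∨ a * d - b * c = -1) → 0 ≤ a * b →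
      E a b c d := by
    intro a b c d h hab
    rcases mul_nonneg_iff.1 hab with h1 | h1
    · exact Epos _ _ _ _ h h1.1 h1.2
    · exact Eneg' _ _ _ _ (Epos _ _ _ _ (by ring_nf at h ⊢; omega) (by omega) (by omega))
  change E a b c d
  have h3 : 0 ≤ a * b ∨ 0 ≤ b * (-a - b) ∨ 0 ≤ (-a - b) * a := by
    by_contra! h
    obtain ⟨h1, h2, h3⟩ := h
    nlinarith [sq_nonneg (a + b)]
  rcases h3 with h3 | h3 | h3
  · exact Eprod _ _ _ _ h h3
  · exact Erot _ _ _ _ (Eprod _ _ _ _ (by ring_nf at h ⊢; omega) h3)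
  · exact Erot _ _ _ _ (Erot _ _ _ _ (Eprod _ _ _ _ (by ring_nf at h ⊢; omega)
      (by ring_nf at h3 ⊢; exact h3)))

/-! ### Values of rational functions at the point `(1, 1, 1)`. -/

theorem algebraMap_ne_zero_of_eval {P : MvPolynomial (Fin 3) ℚ}
    (hP : MvPolynomial.eval (fun _ => (1 : ℚ)) P ≠ 0) :
    algebraMap (MvPolynomial (Fin 3) ℚ) ClusterField P ≠ 0 := by
  intro h0
  have : P = 0 := IsFractionRing.injective (MvPolynomial (Fin 3) ℚ) ClusterField
    (h0.trans (map_zero _).symm)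
  exact hP (by rw [this, map_zero])

/-- Two representations of one fraction cross-multiply to an identity of polynomials, which can be
evaluated. -/
theorem hasValueAtOne_unique {X : ClusterField} {s t : ℚ} (hs : HasValueAtOne X s)
    (ht : HasValueAtOne X t) : s = t := by
  obtain ⟨N, D, hD, hX, rfl⟩ := hs
  obtain ⟨N', D', hD', hX', rfl⟩ := ht
  rw [hX, div_eq_div_iff (algebraMap_ne_zero_of_eval hD) (algebraMap_ne_zero_of_eval hD'),
    ← map_mul, ← map_mul] at hX'
  have h := IsFractionRing.injective (MvPolynomial (Fin 3) ℚ) ClusterField hX'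
  have h' := congrArg (MvPolynomial.eval (fun _ => (1 : ℚ))) h
  rw [map_mul, map_mul] at h'
  rw [div_eq_div_iff hD hD', h']

theorem HasValueAtOne.add {X Y : ClusterField} {s t : ℚ} (hs : HasValueAtOne X s)
    (ht : HasValueAtOne Y t) : HasValueAtOne (X + Y) (s + t) := by
  obtain ⟨N, D, hD, rfl, rfl⟩ := hs
  obtain ⟨N', D', hD', rfl, rfl⟩ := ht
  refine ⟨N * D' + D * N', D * D', ?_, ?_, ?_⟩
  · rw [map_mul]; exact mul_ne_zero hD hD'
  · rw [div_add_div _ _ (algebraMap_ne_zero_of_eval hD) (algebraMap_ne_zero_of_eval hD')]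
    simp only [map_mul, map_add]
  · rw [div_add_div _ _ hD hD']; simp only [map_mul, map_add]

theorem HasValueAtOne.mul {X Y : ClusterField} {s t : ℚ} (hs : HasValueAtOne X s)
    (ht : HasValueAtOne Y t) : HasValueAtOne (X * Y) (s * t) := by
  obtain ⟨N, D, hD, rfl, rfl⟩ := hs
  obtain ⟨N', D', hD', rfl, rfl⟩ := ht
  refine ⟨N * N', D * D', ?_, ?_, ?_⟩
  · rw [map_mul]; exact mul_ne_zero hD hD'
  · rw [div_mul_div_comm]; simp only [map_mul]
  · rw [div_mul_div_comm]; simp only [map_mul]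

theorem HasValueAtOne.div {X Y : ClusterField} {s t : ℚ} (hs : HasValueAtOne X s)
    (ht : HasValueAtOne Y t) (h0 : t ≠ 0) : HasValueAtOne (X / Y) (s / t) := by
  obtain ⟨N, D, hD, rfl, rfl⟩ := hs
  obtain ⟨N', D', hD', rfl, rfl⟩ := ht
  refine ⟨N * D', D * N', ?_, ?_, ?_⟩
  · rw [map_mul]; exact mul_ne_zero hD (div_ne_zero_iff.1 h0).1
  · rw [div_div_div_eq]; simp only [map_mul]
  · rw [div_div_div_eq]; simp only [map_mul]

theorem hasValueAtOne_X (i : Fin 3) :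
    HasValueAtOne (algebraMap (MvPolynomial (Fin 3) ℚ) ClusterField (MvPolynomial.X i)) 1 :=
  ⟨MvPolynomial.X i, 1, by simp, by simp, by simp⟩

/-! ### Seeds carry Markov triples. -/

/-- The properties of the seeds that are obtained from the initial one: the arcs are the sides of an
elementary triangle, and the values of the cluster variables are the Markov numbers of the arcs. -/
structure IsMarkovSeed (S : TorusSeed ClusterField) : Prop where
  sum : S.arc 0 + S.arc 1 + S.arc 2 = 0
  det : (S.arc 0).1 * (S.arc 1).2 - (S.arc 0).2 * (S.arc 1).1 = 1 ∨
    (S.arc 0).1 * (S.arc 1).2 - (S.arc 0).2 * (S.arc 1).1 = -1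
  value : ∀ i, HasValueAtOne (S.var i) (vectorNumber (S.arc i).1 (S.arc i).2)
  pos : ∀ i, 0 < vectorNumber (S.arc i).1 (S.arc i).2
  markov : vectorNumber (S.arc 0).1 (S.arc 0).2 ^ 2 + vectorNumber (S.arc 1).1 (S.arc 1).2 ^ 2 +
    vectorNumber (S.arc 2).1 (S.arc 2).2 ^ 2 = 3 * vectorNumber (S.arc 0).1 (S.arc 0).2 *
      vectorNumber (S.arc 1).1 (S.arc 1).2 * vectorNumber (S.arc 2).1 (S.arc 2).2

/-- The initial seed with the generators of the field of rational functions. -/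
noncomputable abbrev initialVar : Fin 3 → ClusterField :=
  fun i => algebraMap (MvPolynomial (Fin 3) ℚ) ClusterField (MvPolynomial.X i)

theorem isMarkovSeed_initial : IsMarkovSeed (TorusSeed.initial initialVar) where
  sum := by simp [TorusSeed.initial]
  det := by simp [TorusSeed.initial]
  value := by
    intro i
    have := hasValueAtOne_X i
    fin_cases i <;> simpa [TorusSeed.initial, vectorNumber, slopeNumber] using this
  pos := by
    intro i
    fin_cases i <;> simp [TorusSeed.initial, vectorNumber, slopeNumber]
  markov := by simp [TorusSeed.initial, vectorNumber, slopeNumber]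

/-- For the sides `x`, `y` and the diagonals `z`, `z'`, the vector relation `z + z' = 3xy` and the
Markov equation for `z` yield `z z' = x² + y²`, so `z'` is the mutated value. It is positive, and it
is the other root of the quadratic satisfied by `z`. -/
theorem flip_value {X Y Z : ClusterField} {a b c d : ℤ} {e : ℤ × ℤ}
    (hdet : a * d - b * c = 1 ∨ a * d - b * c = -1) (he : e = (-(a + c), -(b + d)))
    (hX : HasValueAtOne X (vectorNumber a b)) (hY : HasValueAtOne Y (vectorNumber c d))
    (hZ : HasValueAtOne Z (vectorNumber e.1 e.2)) (hx : 0 < vectorNumber a b)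
    (hz : 0 < vectorNumber e.1 e.2)
    (hm : vectorNumber e.1 e.2 ^ 2 + vectorNumber a b ^ 2 + vectorNumber c d ^ 2 =
      3 * vectorNumber e.1 e.2 * vectorNumber a b * vectorNumber c d) :
    HasValueAtOne ((X ^ 2 + Y ^ 2) / Z) (vectorNumber (c - a) (d - b)) ∧
      0 < vectorNumber (c - a) (d - b) ∧
      vectorNumber (c - a) (d - b) ^ 2 + vectorNumber a b ^ 2 + vectorNumber c d ^ 2 =
      3 * vectorNumber (c - a) (d - b) * vectorNumber a b * vectorNumber c d := by
  have h1 := vectorNumber_exchange hdet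
  rw [← vectorNumber_neg (a - c), neg_sub, neg_sub, ← vectorNumber_neg (a + c)] at h1
  subst he
  simp only at *
  generalize vectorNumber (-(a + c)) (-(b + d)) = z at *
  generalize vectorNumber (c - a) (d - b) = z' at *
  generalize vectorNumber a b = x at *
  generalize vectorNumber c d = y at *
  have h2 : z * z' = x ^ 2 + y ^ 2 := by linear_combination z * h1 - hm
  refine ⟨?_, ?_, ?_⟩
  · have h3 : (z' : ℚ) = ((x : ℚ) * x + y * y) / z := by
      rw [eq_div_iff (by exact_mod_cast hz.ne')]
      have : (z : ℚ) * z' = x ^ 2 + y ^ 2 := by exact_mod_cast h2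
      linear_combination this
    rw [h3, pow_two, pow_two]
    exact ((hX.mul hX).add (hY.mul hY)).div hZ (by exact_mod_cast hz.ne')
  · refine pos_of_mul_pos_right (a := z) ?_ hz.le
    rw [h2]; positivity
  · linear_combination z' * h1 - h2

theorem IsMarkovSeed.mutate {S : TorusSeed ClusterField} (h : IsMarkovSeed S) (k : Fin 3) :
    IsMarkovSeed (S.mutate k) := by
  obtain ⟨hs, hd, hv, hp, hm⟩ := h
  rcases S with ⟨arc, var⟩
  obtain ⟨a, b, e0⟩ : ∃ a b, arc 0 = (a, b) := ⟨_, _, rfl⟩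
  obtain ⟨c, d, e1⟩ : ∃ a b, arc 1 = (a, b) := ⟨_, _, rfl⟩
  obtain ⟨e, f, e2⟩ : ∃ a b, arc 2 = (a, b) := ⟨_, _, rfl⟩
  simp only [e0, e1, e2, Prod.mk_add_mk, Prod.mk_eq_zero] at hs hd hm
  have v0 := hv 0
  have v1 := hv 1
  have v2 := hv 2
  have p0 := hp 0
  have p1 := hp 1
  have p2 := hp 2
  simp only [e0, e1, e2] at v0 v1 v2 p0 p1 p2
  obtain ⟨hs1, hs2⟩ := hs
  fin_cases k
  · obtain ⟨h1, h2, h3⟩ := flip_value (a := c) (b := d) (c := e) (d := f) (e := (a, b))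
      (by rw [show e = -a - c by linarith, show f = -b - d by linarith]; ring_nf at hd ⊢; omega)
      (by rw [Prod.mk.injEq]; constructor <;> linarith) v1 v2 v0 p1 p0 (by linarith)
    refine ⟨?_, ?_, ?_, ?_, ?_⟩
    · simp [TorusSeed.mutate, e1, e2]
    · simp [TorusSeed.mutate, e1, e2]
      rw [show e = -a - c by linarith, show f = -b - d by linarith]; ring_nf at hd ⊢; omega
    · intro i
      fin_cases i <;> simp [TorusSeed.mutate, vectorNumber_neg, *]
    · intro i
      fin_cases i <;> simp [TorusSeed.mutate, vectorNumber_neg, *]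
    · simp [TorusSeed.mutate, e1, e2, vectorNumber_neg]
      linarith
  · obtain ⟨h1, h2, h3⟩ := flip_value (a := e) (b := f) (c := a) (d := b) (e := (c, d))
      (by rw [show e = -a - c by linarith, show f = -b - d by linarith]; ring_nf at hd ⊢; omega)
      (by rw [Prod.mk.injEq]; constructor <;> linarith) v2 v0 v1 p2 p1 (by linarith)
    refine ⟨?_, ?_, ?_, ?_, ?_⟩
    · simp [TorusSeed.mutate, e0, e2]
      constructor <;> ring
    · simp [TorusSeed.mutate, e0, e2]
      rw [show e = -a - c by linarith, show f = -b - d by linarith]; ring_nf at hd ⊢; omega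
    · intro i
      fin_cases i <;> simp [TorusSeed.mutate, vectorNumber_neg, *]
    · intro i
      fin_cases i <;> simp [TorusSeed.mutate, vectorNumber_neg, *]
    · simp [TorusSeed.mutate, e0, e2, vectorNumber_neg]
      linarith
  · obtain ⟨h1, h2, h3⟩ := flip_value (a := a) (b := b) (c := c) (d := d) (e := (e, f)) hd
      (by rw [Prod.mk.injEq]; constructor <;> linarith) v0 v1 v2 p0 p2 (by linarith)
    refine ⟨?_, ?_, ?_, ?_, ?_⟩
    · simp [TorusSeed.mutate, e0, e1]
      constructor <;> ring
    · simp [TorusSeed.mutate, e0, e1]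
      ring_nf at hd ⊢; omega
    · intro i
      fin_cases i <;> simp [TorusSeed.mutate, vectorNumber_neg, *]
    · intro i
      fin_cases i <;> simp [TorusSeed.mutate, vectorNumber_neg, *]
    · simp [TorusSeed.mutate, e0, e1, vectorNumber_neg]
      linarith

theorem isMarkovSeed_of_reachable {S : TorusSeed ClusterField}
    (h : TorusSeed.Reachable initialVar S) : IsMarkovSeed S := by
  induction h with
  | init => exact isMarkovSeed_initial
  | step S k _ ih => exact ih.mutate k

/-! ### Every slope is realised by an arc. -/

/-- Two vectors are, up to a common sign, arcs of a seed obtained from the initial one. -/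
def ArcsOfReachableSeed (u v : ℤ × ℤ) : Prop :=
  ∃ S : TorusSeed ClusterField, TorusSeed.Reachable initialVar S ∧ ∃ i j : Fin 3, i ≠ j ∧
    ((S.arc i = u ∧ S.arc j = v) ∨ (S.arc i = -u ∧ S.arc j = -v))

theorem ArcsOfReachableSeed.symm {u v : ℤ × ℤ} (h : ArcsOfReachableSeed u v) :
    ArcsOfReachableSeed v u := by
  obtain ⟨S, hS, i, j, hij, h⟩ := h
  exact ⟨S, hS, j, i, hij.symm, h.imp And.symm And.symm⟩

theorem ArcsOfReachableSeed.third {u v : ℤ × ℤ} (h : ArcsOfReachableSeed u v) :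
    ArcsOfReachableSeed v (-(u + v)) := by
  obtain ⟨S, hS, i, j, hij, h⟩ := h
  have hs := (isMarkovSeed_of_reachable hS).sum
  obtain ⟨k, hk, hsum⟩ : ∃ k, j ≠ k ∧ S.arc k = -(S.arc i + S.arc j) := by
    have : ∀ x y z : ℤ × ℤ, x + y + z = 0 → z = -(x + y) := fun x y z h =>
      eq_neg_of_add_eq_zero_right h
    -- Since `0 + 1 + 2 = 0` in `Fin 3`, the index different from `i` and `j` is `-(i + j)`.
    refine ⟨-(i + j), ?_, ?_⟩
    · fin_cases i <;> fin_cases j <;> first | decide | exact absurd rfl hij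
    · apply this
      rw [← hs]
      fin_cases i <;> fin_cases j <;> first | exact absurd rfl hij |
        (simp [show (-1 : Fin 3) = 2 from rfl, show (-2 : Fin 3) = 1 from rfl,
          show (1 + 2 : Fin 3) = 0 from rfl, show (2 + 1 : Fin 3) = 0 from rfl]; try abel)
  refine ⟨S, hS, j, k, hk, ?_⟩
  rcases h with ⟨h1, h2⟩ | ⟨h1, h2⟩
  · left; rw [hsum, h1, h2]; exact ⟨rfl, rfl⟩
  · right; rw [hsum, h1, h2]; refine ⟨rfl, by abel⟩

/-- Mutation at the third arc keeps one of the two given vectors and negates the other. Which one is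
negated is immaterial, as a common sign is free. -/
theorem ArcsOfReachableSeed.flip {u v : ℤ × ℤ} (h : ArcsOfReachableSeed u v) :
    ArcsOfReachableSeed u (-v) := by
  obtain ⟨S, hS, i, j, hij, h⟩ := h
  refine ⟨S.mutate (-(i + j)), .step _ _ hS, i, j, hij, ?_⟩
  have key : ∀ k, (S.mutate k).arc (k + 1) = S.arc (k + 1) ∧
      (S.mutate k).arc (k + 2) = - S.arc (k + 2) := by
    intro k
    fin_cases k <;> simp [TorusSeed.mutate]
  obtain ⟨k, hk⟩ : ∃ k, k = -(i + j) := ⟨_, rfl⟩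
  rw [← hk]
  have hcase : (i = k + 1 ∧ j = k + 2) ∨ (i = k + 2 ∧ j = k + 1) := by
    subst hk
    fin_cases i <;> fin_cases j <;> first | exact absurd rfl hij | decide
  obtain ⟨k1, k2⟩ := key k
  rcases hcase with ⟨rfl, rfl⟩ | ⟨rfl, rfl⟩
  · rw [k1, k2]
    rcases h with ⟨h1, h2⟩ | ⟨h1, h2⟩
    · left; exact ⟨h1, by rw [h2]⟩
    · right; exact ⟨h1, by rw [h2]⟩
  · rw [k1, k2]
    rcases h with ⟨h1, h2⟩ | ⟨h1, h2⟩
    · right; exact ⟨by rw [h1], by rw [h2, neg_neg]⟩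
    · left; exact ⟨by rw [h1, neg_neg], h2⟩

theorem arcsOfReachableSeed_of_farey {a b c d : ℕ} (h : b * c = d * a + 1) :
    ArcsOfReachableSeed ((a : ℤ), (b : ℤ)) ((c : ℤ), (d : ℤ)) := by
  refine farey_induction (P := fun a b c d : ℕ =>
    ArcsOfReachableSeed ((a : ℤ), (b : ℤ)) ((c : ℤ), (d : ℤ))) ?_ ?_ ?_ a b c d h
  · have h0 : ArcsOfReachableSeed (1, 0) (0, -1) :=
      ⟨_, .init, 0, 1, by decide, Or.inl ⟨by simp [TorusSeed.initial], by simp [TorusSeed.initial]⟩⟩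
    simpa using h0.flip.symm
  · intro a b c d _ ih
    have := ih.symm.third.flip
    simpa [add_comm] using this
  · intro a b c d _ ih
    have := ih.third.flip.symm
    simpa using this

theorem exists_seed_of_coprime {p q : ℕ} (hp : 0 < p) (hpq : p < q) (h : Nat.Coprime p q) :
    ∃ S : TorusSeed ClusterField, TorusSeed.Reachable initialVar S ∧
      ∃ i, S.arc i = ((q : ℤ), (p : ℤ)) ∨ S.arc i = (-(q : ℤ), -(p : ℤ)) := by
  -- With `m` an inverse of `p` modulo `q`, the vector `(m, ⌊pm/q⌋)` completes `(q, p)` to a Farey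
  -- pair.
  obtain ⟨m, -, hm⟩ := Nat.exists_mul_mod_eq_one_of_coprime h (by omega)
  have h1 : m * p = q * (p * m / q) + 1 := by
    conv_lhs => rw [mul_comm, ← Nat.div_add_mod (p * m) q, hm]
  have h2 : p * m = (p * m / q) * q + 1 := by linarith
  obtain ⟨S, hS, i, j, -, h⟩ := arcsOfReachableSeed_of_farey h2
  exact ⟨S, hS, i, h.imp And.left And.left⟩

/-- Well-definedness is obtained for values: every seed containing the arc gives the same number, so
uniqueness of the cluster variable as a rational function is not needed. -/
theorem isMarkovNumberOfSlope_iff {p q : ℕ} (hp : 0 < p) (hpq : p < q) (h : Nat.Coprime p q)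
    (m : ℕ) : IsMarkovNumberOfSlope p q m ↔ (m : ℤ) = slopeNumber q p := by
  have key : ∀ S : TorusSeed ClusterField, TorusSeed.Reachable initialVar S →
      ∀ i, (S.arc i = ((q : ℤ), (p : ℤ)) ∨ S.arc i = (-(q : ℤ), -(p : ℤ))) →
      HasValueAtOne (S.var i) (slopeNumber q p) := by
    intro S hS i hi
    have := (isMarkovSeed_of_reachable hS).value i
    rcases hi with hi | hi
    · rwa [hi, vectorNumber_natCast] at this
    · rwa [hi, vectorNumber_neg, vectorNumber_natCast] at this
  constructor
  · rintro ⟨X, ⟨S, hS, i, hi, rfl⟩, hX⟩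
    have := hasValueAtOne_unique hX (key S hS i hi)
    exact_mod_cast this
  · intro hm
    obtain ⟨S, hS, i, hi⟩ := exists_seed_of_coprime hp hpq h
    refine ⟨_, ⟨S, hS, i, hi, rfl⟩, ?_⟩
    have := key S hS i hi
    rw [← hm] at this
    exact_mod_cast this

theorem exists_markovNumber_eq_slopeNumber {p q : ℕ} (hp : 0 < p) (hpq : p < q)
    (h : Nat.Coprime p q) : ∃ m : ℕ, (m : ℤ) = slopeNumber q p ∧ IsMarkovNumber m := by
  obtain ⟨S, hS, i, hi⟩ := exists_seed_of_coprime hp hpq h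
  have hM := isMarkovSeed_of_reachable hS
  have hv : vectorNumber (S.arc i).1 (S.arc i).2 = slopeNumber q p := by
    rcases hi with hi | hi
    · rw [hi, vectorNumber_natCast]
    · rw [hi, vectorNumber_neg, vectorNumber_natCast]
  choose f hf using fun i => Int.eq_ofNat_of_zero_le (hM.pos i).le
  have hpos : ∀ i, 0 < f i := fun i => by have := hM.pos i; rw [hf i] at this; exact_mod_cast this
  have hm := hM.markov
  rw [hf 0, hf 1, hf 2] at hm
  refine ⟨f i, by rw [← hv, hf i], f (i + 1), f (i + 2), hpos _, hpos _, hpos _, ?_⟩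
  zify
  fin_cases i <;> simp <;> linarith

/-! ### Vieta descent: every Markov number is reached. -/

theorem slopeNumber_one_one : slopeNumber 1 1 = 2 := by
  simp [slopeNumber, slopeMat, vMat, hMat, Matrix.mul_apply, Fin.sum_univ_two]

theorem slopeNumber_two_one : slopeNumber 2 1 = 5 := by
  simp [slopeNumber, slopeMat, vMat, hMat, Matrix.mul_apply, Fin.sum_univ_two, pow_two]

/-- Here `z` and `z'` are the roots of `t² - 3xyt + x² + y²`. Its value at `y` is `x² + 2y² - 3xy² ≤
0`, so `y` lies between the roots. Equality `y = z` occurs only at `(1, 1, 1)`, which `5 ≤ z`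
excludes. -/
theorem markov_vieta {x y z : ℕ} (hx : 0 < x) (hxy : x ≤ y) (hyz : y ≤ z) (hz : 5 ≤ z)
    (h : x ^ 2 + y ^ 2 + z ^ 2 = 3 * x * y * z) :
    ∃ z', 0 < z' ∧ z' ≤ y ∧ y < z ∧ z + z' = 3 * x * y ∧ x ^ 2 + y ^ 2 + z' ^ 2 = 3 * x * y * z' := by
  have h1 : z ≤ 3 * x * y := by
    refine Nat.le_of_mul_le_mul_right ?_ (show 0 < z by omega)
    rw [← h]; nlinarith
  obtain ⟨z', hz'⟩ := Nat.exists_eq_add_of_le h1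
  have h2 : z * z' = x ^ 2 + y ^ 2 := by rw [hz'] at h; nlinarith
  have hx2 : 0 < x ^ 2 := by positivity
  have hlt : y < z := by
    rcases hyz.eq_or_lt with rfl | hlt
    · exfalso
      have h3 : x ^ 2 + y ^ 2 + y ^ 2 = 3 * x * y ^ 2 := by rw [h]; ring
      have h4 : x ^ 2 ≤ y ^ 2 := Nat.pow_le_pow_left hxy 2
      have h5 : x = 1 := by
        by_contra hne
        have : 2 ≤ x := by omega
        nlinarith
      subst h5
      nlinarith
    · exact hlt
  refine ⟨z', ?_, ?_, hlt, hz'.symm, ?_⟩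
  · by_contra h0
    have : z' = 0 := by omega
    subst this
    omega
  · by_contra hlt'
    push Not at hlt'
    have h6 : x ^ 2 + 2 * y ^ 2 ≤ 3 * x * y ^ 2 := by
      have : x ^ 2 ≤ x * y ^ 2 := by
        rw [pow_two x]
        apply Nat.mul_le_mul_left
        nlinarith
      have : y ^ 2 ≤ x * y ^ 2 := Nat.le_mul_of_pos_left _ hx
      linarith
    zify at *
    nlinarith [mul_pos (sub_pos.2 hlt) (sub_pos.2 hlt')]
  · rw [hz', ← h2]; ring

/-- Induction on the largest member. The smaller triple `(x, w, y)` comes from a Farey pair with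
mediant value `y`; replacing by the mediant the vector with value `w` gives a pair for `(x, y, z)`,
by the additive recursion. The conditions `b ≤ a`, `d ≤ c` keep the slopes at most `1`. -/
theorem exists_farey_of_markov (n : ℕ) : ∀ x y z : ℕ, z = n → 0 < x → x ≤ y → y ≤ z → 5 ≤ z →
    x ^ 2 + y ^ 2 + z ^ 2 = 3 * x * y * z →
    ∃ a b c d : ℕ, b * c = d * a + 1 ∧ b ≤ a ∧ d ≤ c ∧
      (((x : ℤ) = slopeNumber a b ∧ (y : ℤ) = slopeNumber c d) ∨
        ((x : ℤ) = slopeNumber c d ∧ (y : ℤ) = slopeNumber a b)) ∧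
      (z : ℤ) = slopeNumber (a + c) (b + d) := by
  induction n using Nat.strong_induction_on with
  | _ n ih =>
  intro x y z hzn hx hxy hyz hz h
  obtain ⟨w, hw, hwy, hlt, hsum, hm⟩ := markov_vieta hx hxy hyz hz h
  have hsum' : (z : ℤ) = 3 * x * y - w := by
    have : (z : ℤ) + w = 3 * x * y := by exact_mod_cast hsum
    linarith
  rcases Nat.lt_or_ge y 5 with hy | hy
  -- The descent stops at `(1, 2, 5)`, carried by `(1, 0)`, `(1, 1)` and their mediant `(2, 1)`.
  · have hxyz : x = 1 ∧ y = 2 ∧ z = 5 := by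
      interval_cases y <;> interval_cases x <;> interval_cases w <;> omega
    obtain ⟨rfl, rfl, rfl⟩ := hxyz
    exact ⟨1, 1, 1, 0, rfl, le_rfl, by omega,
      Or.inr ⟨by rw [slopeNumber_zero_right]; rfl, by rw [slopeNumber_one_one]; rfl⟩,
      by rw [slopeNumber_two_one]; rfl⟩
  · obtain ⟨a, b, c, d, hd, hab, hcd, h1, h2⟩ : ∃ a b c d : ℕ, b * c = d * a + 1 ∧ b ≤ a ∧ d ≤ c ∧
      (((x : ℤ) = slopeNumber a b ∧ (w : ℤ) = slopeNumber c d) ∨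
        ((x : ℤ) = slopeNumber c d ∧ (w : ℤ) = slopeNumber a b)) ∧
      (y : ℤ) = slopeNumber (a + c) (b + d) := by
      rcases le_total x w with hxw | hxw
      · exact ih y (by omega) x w y rfl hx hxw hwy hy (by rw [← Nat.add_right_comm, hm]; ring)
      · obtain ⟨a, b, c, d, hd, hab, hcd, h1, h2⟩ :=
          ih y (by omega) w x y rfl hw hxw hxy hy (by linarith)
        exact ⟨a, b, c, d, hd, hab, hcd, by tauto, h2⟩
    rcases h1 with ⟨h1, h3⟩ | ⟨h1, h3⟩
    · refine ⟨a, b, a + c, b + d, by nlinarith, hab, by omega, Or.inl ⟨h1, h2⟩, ?_⟩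
      rw [hsum', h1, h2, h3, ← slopeNumber_add_left hd]; ring
    · refine ⟨a + c, b + d, c, d, by nlinarith, by omega, hcd, Or.inr ⟨h1, h2⟩, ?_⟩
      rw [hsum', h1, h2, h3, ← slopeNumber_add_right hd]; ring

/-- The number `m` is `1`, `2` or the Markov number of a slope strictly between `0` and `1`. -/
def IsSlopeNumber (m : ℕ) : Prop :=
  m = 1 ∨ m = 2 ∨ ∃ p q : ℕ, 0 < p ∧ p < q ∧ Nat.Coprime p q ∧ (m : ℤ) = slopeNumber q p

theorem isSlopeNumber_of_eq {m a b : ℕ} (h : Nat.Coprime a b) (hab : b ≤ a)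
    (hm : (m : ℤ) = slopeNumber a b) : IsSlopeNumber m := by
  rcases Nat.eq_zero_or_pos b with rfl | hb
  · rw [slopeNumber_zero_right] at hm
    exact Or.inl (by exact_mod_cast hm)
  rcases hab.eq_or_lt with rfl | hlt
  · have : b = 1 := by simpa using h
    subst this
    rw [slopeNumber_one_one] at hm
    exact Or.inr (Or.inl (by exact_mod_cast hm))
  · exact Or.inr (Or.inr ⟨b, a, hb, hlt, h.symm, hm⟩)

theorem isSlopeNumber_of_sorted {x y z : ℕ} (hx : 0 < x) (hxy : x ≤ y) (hyz : y ≤ z)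
    (h : x ^ 2 + y ^ 2 + z ^ 2 = 3 * x * y * z) :
    IsSlopeNumber x ∧ IsSlopeNumber y ∧ IsSlopeNumber z := by
  rcases Nat.lt_or_ge z 5 with hz | hz
  · have : x ≤ 2 ∧ y ≤ 2 ∧ z ≤ 2 := by
      interval_cases z <;> interval_cases y <;> interval_cases x <;> omega
    exact ⟨by unfold IsSlopeNumber; omega, by unfold IsSlopeNumber; omega,
      by unfold IsSlopeNumber; omega⟩
  · obtain ⟨a, b, c, d, hd, hab, hcd, h1, h2⟩ := exists_farey_of_markov z x y z rfl hx hxy hyz hz h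
    obtain ⟨c1, c2, c3⟩ := coprime_of_farey hd
    refine ⟨?_, ?_, isSlopeNumber_of_eq c3 (by omega) h2⟩
    · rcases h1 with ⟨h1, h3⟩ | ⟨h1, h3⟩
      · exact isSlopeNumber_of_eq c1 hab h1
      · exact isSlopeNumber_of_eq c2 hcd h1
    · rcases h1 with ⟨h1, h3⟩ | ⟨h1, h3⟩
      · exact isSlopeNumber_of_eq c2 hcd h3
      · exact isSlopeNumber_of_eq c1 hab h3

theorem isSlopeNumber_of_isMarkovNumber {m : ℕ} (h : IsMarkovNumber m) : IsSlopeNumber m := by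
  obtain ⟨y, z, hm, hy, hz, h⟩ := h
  rcases le_total m y with h1 | h1 <;> rcases le_total y z with h2 | h2 <;>
    rcases le_total m z with h3 | h3
  · exact (isSlopeNumber_of_sorted hm h1 h2 h).1
  · exact (isSlopeNumber_of_sorted hm h1 h2 h).1
  · exact (isSlopeNumber_of_sorted hm h3 h2 (by linarith)).1
  · exact (isSlopeNumber_of_sorted hz h3 h1 (by linarith)).2.1
  · exact (isSlopeNumber_of_sorted hy h1 h3 (by linarith)).2.1
  · exact (isSlopeNumber_of_sorted hy h2 h3 (by linarith)).2.2
  · exact (isSlopeNumber_of_sorted hz h2 h1 (by linarith)).2.2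
  · exact (isSlopeNumber_of_sorted hz h2 h1 (by linarith)).2.2

/-! ### Length, symmetry and injectivity of the sequence. -/

/-- Each separator `2, 2` is shared between its two neighbours. For `p = 0` this would fail, as the
outer `2`s would remain. -/
theorem markovCF_eq_flatMap {p q : ℕ} (hp : 0 < p) :
    markovCF p q = (List.range p).flatMap fun i =>
      [2] ++ List.replicate (2 * (crossing p q (i + 1) - 1)) 1 ++ [2] := by
  have key : ∀ (g : ℕ → List ℕ) (l : List ℕ), l ≠ [] →
      [2] ++ List.intercalate [2, 2] (l.map g) ++ [2] = l.flatMap fun i => [2] ++ g i ++ [2] := by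
    intro g l hl
    induction l with
    | nil => exact absurd rfl hl
    | cons i l ih =>
      rcases l with _ | ⟨j, l⟩
      · simp
      · have := ih (by simp)
        rw [List.flatMap_cons, ← this]
        simp
  exact key _ _ (by simpa using hp.ne')

theorem crossingSum_le {p q i : ℕ} (hp : 0 < p) : crossingSum p q i ≤ i * q / p := by
  unfold crossingSum
  split_ifs with h
  · subst h; rw [Nat.mul_div_cancel_left _ hp]; omega
  · rfl

theorem lt_crossingSum_succ {p q i : ℕ} (hpq : p < q) (hi : i < p) :
    crossingSum p q i < crossingSum p q (i + 1) := by
  have hp : 0 < p := by omega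
  refine (crossingSum_le hp).trans_lt ?_
  unfold crossingSum
  split_ifs with h
  · obtain rfl : i = p - 1 := by omega
    rw [Nat.div_lt_iff_lt_mul hp]
    zify [show 1 ≤ p by omega, show 1 ≤ q by omega]
    nlinarith
  · rw [Nat.lt_iff_add_one_le, ← Nat.add_div_right _ hp]
    apply Nat.div_le_div_right
    nlinarith

theorem crossing_succ_eq (p q i : ℕ) :
    crossing p q (i + 1) = crossingSum p q (i + 1) - crossingSum p q i := rfl

theorem crossing_pos {p q i : ℕ} (hpq : p < q) (hi : i < p) : 0 < crossing p q (i + 1) :=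
  Nat.sub_pos_of_lt (lt_crossingSum_succ hpq hi)

theorem sum_crossing {p q : ℕ} (hp : 0 < p) (hpq : p < q) :
    ((List.range p).map fun i => crossing p q (i + 1)).sum = q - 1 := by
  have : ∀ m ≤ p, ((List.range m).map fun i => crossing p q (i + 1)).sum = crossingSum p q m := by
    intro m hm
    induction m with
    | zero => simp [crossingSum, hp.ne]
    | succ m ih =>
      rw [List.range_succ, List.map_append, List.sum_append, ih (by omega), List.map_singleton,
        List.sum_singleton, crossing_succ_eq]
      have := lt_crossingSum_succ hpq (i := m) (by omega)
      omega
  rw [this p le_rfl, crossingSum, if_pos rfl]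

theorem length_markovCF {p q : ℕ} (hp : 0 < p) (hpq : p < q) :
    (markovCF p q).length = 2 * (q - 1) := by
  rw [markovCF_eq_flatMap hp, List.length_flatMap, ← sum_crossing hp hpq, ← List.sum_map_mul_left]
  congr 1
  apply List.map_congr_left
  intro i hi
  have := crossing_pos hpq (List.mem_range.1 hi)
  simp
  omega

theorem count_two_markovCF {p q : ℕ} (hp : 0 < p) : (markovCF p q).count 2 = 2 * p := by
  rw [markovCF_eq_flatMap hp, List.count_flatMap]
  have : (List.count 2 ∘ fun i => [2] ++ List.replicate (2 * (crossing p q (i + 1) - 1)) 1 ++ [2])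
      = fun _ => 2 := by
    funext i
    simp [List.count_replicate]
  rw [this]
  simp [mul_comm]

/-- The number `2p` of entries `2` and the length `2(q - 1)` recover numerator and denominator. -/
theorem injOn_markovCF :
    Set.InjOn (fun r : ℚ => markovCF r.num.toNat r.den) (Set.Ioo (0 : ℚ) 1) := by
  have key : ∀ r : ℚ, r ∈ Set.Ioo (0 : ℚ) 1 → 0 < r.num ∧ 0 < r.num.toNat ∧ r.num.toNat < r.den := by
    intro r hr
    have h1 : 0 < r.num := Rat.num_pos.2 hr.1
    have h2 : r.num < r.den := by
      have := hr.2
      rwa [← Rat.num_lt_denom_iff] at this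
    omega
  intro r hr s hs h
  obtain ⟨r1, r2, r3⟩ := key r hr
  obtain ⟨s1, s2, s3⟩ := key s hs
  simp only at h
  have h1 := count_two_markovCF (q := r.den) r2
  have h2 := length_markovCF r2 r3
  rw [h, count_two_markovCF s2] at h1
  rw [h, length_markovCF s2 s3] at h2
  apply Rat.ext <;> omega

/-- Central symmetry of the segment: for `0 < j < p` the number `jq/p` is not an integer, so `⌊q -
jq/p⌋ = q - 1 - ⌊jq/p⌋`. The convention `s_p = q - 1` makes this hold at both ends as well. -/
theorem crossing_reflect {p q i : ℕ} (h : Nat.Coprime p q) (hpq : p < q) (hi : i < p) :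
    crossing p q (p - 1 - i + 1) = crossing p q (i + 1) := by
  have key : ∀ j ≤ p, crossingSum p q (p - j) = q - 1 - crossingSum p q j := by
    intro j hj
    have hp : 0 < p := by omega
    rcases hj.eq_or_lt with rfl | hj
    · simp [crossingSum, hp.ne]
    rcases Nat.eq_zero_or_pos j with rfl | hj0
    · simp [crossingSum, hp.ne]
    rw [crossingSum, if_neg (by omega), crossingSum, if_neg (by omega)]
    have hr : 0 < j * q % p := by
      refine Nat.pos_of_ne_zero fun h0 => ?_
      have := Nat.le_of_dvd hj0 (h.dvd_of_dvd_mul_right (Nat.dvd_of_mod_eq_zero h0))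
      omega
    have hk : j * q / p < q := (Nat.div_lt_iff_lt_mul hp).2 (by nlinarith)
    have h1 := Nat.div_add_mod (j * q) p
    have h2 := Nat.mod_lt (j * q) hp
    generalize j * q / p = k at *
    generalize j * q % p = r at *
    obtain ⟨e, rfl⟩ := Nat.exists_eq_add_of_lt hk
    obtain ⟨f, rfl⟩ := Nat.exists_eq_add_of_lt hj
    rw [show k + e + 1 - 1 - k = e by omega, show j + f + 1 - j = f + 1 by omega]
    apply Nat.div_eq_of_lt_le <;> nlinarith
  have hle : crossingSum p q (i + 1) ≤ q - 1 := by
    unfold crossingSum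
    split_ifs with h0
    · rfl
    · apply Nat.le_sub_one_of_lt
      rw [Nat.div_lt_iff_lt_mul (by omega)]
      nlinarith [show i + 1 < p by omega]
  have hlt := lt_crossingSum_succ hpq hi
  rw [crossing_succ_eq, crossing_succ_eq, show p - 1 - i + 1 = p - i by omega,
    show p - 1 - i = p - (i + 1) by omega, key i hi.le, key (i + 1) hi]
  omega

theorem palindrome_markovCF {p q : ℕ} (hp : 0 < p) (hpq : p < q) (h : Nat.Coprime p q) :
    (markovCF p q).reverse = markovCF p q := by
  rw [markovCF_eq_flatMap hp, List.reverse_flatMap, List.range_eq_range', List.reverse_range',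
    ← List.range_eq_range', List.flatMap_map]
  apply List.flatMap_congr
  intro i hi
  have := crossing_reflect h hpq (List.mem_range.1 hi)
  simp [this]

theorem mem_markovCF {p q x : ℕ} (hp : 0 < p) (hx : x ∈ markovCF p q) : x = 1 ∨ x = 2 := by
  rw [markovCF_eq_flatMap hp, List.mem_flatMap] at hx
  obtain ⟨i, -, hx⟩ := hx
  simp [List.mem_replicate] at hx
  omega

theorem exists_half_markovCF {p q : ℕ} (hp : 0 < p) (hpq : p < q) (h : Nat.Coprime p q) :
    ∃ a : List ℕ, markovCF p q = a.reverse ++ a ∧ (∀ x ∈ a, x = 1 ∨ x = 2) ∧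
      a.getLast? = some 2 ∧ (p + 1 = q → a.length = p ∧ ∀ x ∈ a, x = 2) := by
  have hpal := palindrome_markovCF hp hpq h
  have hlen := length_markovCF hp hpq
  have hmem := fun x => mem_markovCF (q := q) (x := x) hp
  have hcount := count_two_markovCF (q := q) hp
  have hlast : (markovCF p q).getLast? = some 2 := by
    rw [markovCF, List.getLast?_append_of_ne_nil _ (by simp)]; rfl
  generalize markovCF p q = L at *
  obtain ⟨a, b, rfl, hab⟩ : ∃ a b, L = b ++ a ∧ b.length = q - 1 :=
    ⟨L.drop (q - 1), L.take (q - 1), (List.take_append_drop _ _).symm, by simp; omega⟩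
  have ha : a.length = q - 1 := by rw [List.length_append] at hlen; omega
  rw [List.reverse_append] at hpal
  have h1 := (List.append_inj hpal (by simp; omega)).1
  subst h1
  refine ⟨a, rfl, fun x hx => hmem x (by simp [hx]), ?_, ?_⟩
  · have : a ≠ [] := by rintro rfl; simp at ha; omega
    rwa [List.getLast?_append_of_ne_nil _ this] at hlast
  · intro hq
    refine ⟨by omega, ?_⟩
    rw [List.count_append, List.count_reverse] at hcount
    have : a.count 2 = a.length := by omega
    intro x hx
    exact (List.count_eq_length.1 this x hx).symm

/-! ### Numerators of continued fractions through matrices. -/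

/-- The numerator and the denominator of a continued fraction. -/
def cfPair : List ℕ → Fin 2 → ℤ
  | [] => ![1, 0]
  | a :: l => !![(a : ℤ), 1; 1, 0] *ᵥ cfPair l

theorem cfPair_cons (a : ℕ) (l : List ℕ) :
    cfPair (a :: l) 0 = a * cfPair l 0 + cfPair l 1 ∧ cfPair (a :: l) 1 = cfPair l 0 := by
  simp [cfPair, Matrix.mulVec, dotProduct, Fin.sum_univ_two]

theorem cfPair_isCoprime (l : List ℕ) : IsCoprime (cfPair l 0) (cfPair l 1) := by
  induction l with
  | nil => exact isCoprime_one_left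
  | cons a l ih =>
    rw [(cfPair_cons a l).1, (cfPair_cons a l).2, add_comm]
    exact (ih.symm).add_mul_right_left _

theorem cfPair_pos {l : List ℕ} (h : ∀ x ∈ l, 0 < x) : 0 < cfPair l 0 ∧ 0 ≤ cfPair l 1 := by
  induction l with
  | nil => simp [cfPair]
  | cons a l ih =>
    rw [(cfPair_cons a l).1, (cfPair_cons a l).2]
    obtain ⟨h1, h2⟩ := ih fun x hx => h x (List.mem_cons_of_mem _ hx)
    have : (0 : ℤ) < a := by exact_mod_cast h a (by simp)
    exact ⟨by positivity, h1.le⟩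

theorem cfValue_eq {l : List ℕ} (hl : l ≠ []) (h : ∀ x ∈ l, 0 < x) :
    cfValue l = cfPair l 0 / cfPair l 1 := by
  induction l with
  | nil => exact absurd rfl hl
  | cons a l ih =>
    rcases l with _ | ⟨b, l⟩
    · simp [cfValue, cfPair, Matrix.mulVec, dotProduct, Fin.sum_univ_two]
    · have h' : ∀ x ∈ b :: l, 0 < x := fun x hx => h x (List.mem_cons_of_mem _ hx)
      rw [cfValue, ih (by simp) h', (cfPair_cons a _).1, (cfPair_cons a _).2]
      have : (cfPair (b :: l) 0 : ℚ) ≠ 0 := by exact_mod_cast (cfPair_pos h').1.ne'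
      push_cast
      rw [one_div_div, add_div, mul_div_cancel_right₀ _ this]

theorem num_cfValue {l : List ℕ} (hl : l ≠ []) (h : ∀ x ∈ l, 0 < x) :
    (cfValue l).num = cfPair l 0 := by
  rw [cfValue_eq hl h]
  apply Rat.num_div_eq_of_coprime
  · rcases l with _ | ⟨a, l⟩
    · exact absurd rfl hl
    · rw [(cfPair_cons a l).2]
      exact (cfPair_pos fun x hx => h x (List.mem_cons_of_mem _ hx)).1
  · exact Int.isCoprime_iff_nat_coprime.1 (cfPair_isCoprime l)

/-- The product of the matrices `(a, 1; 1, 0)` over the entries `a` of a continued fraction. -/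
def cfMat (l : List ℕ) : Matrix (Fin 2) (Fin 2) ℤ :=
  (l.map fun a : ℕ => !![(a : ℤ), 1; 1, 0]).prod

theorem cfPair_eq (l : List ℕ) : cfPair l 0 = cfMat l 0 0 := by
  have : ∀ l, cfPair l = cfMat l *ᵥ ![1, 0] := by
    intro l
    induction l with
    | nil => simp [cfPair, cfMat]
    | cons a l ih => rw [cfPair, ih, Matrix.mulVec_mulVec]; rfl
  rw [this]
  simp [Matrix.mulVec, dotProduct, Fin.sum_univ_two]

theorem cfMat_append (l l' : List ℕ) : cfMat (l ++ l') = cfMat l * cfMat l' := by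
  simp [cfMat]

theorem cfMat_two : cfMat [2] = !![2, 1; 1, 0] := by simp [cfMat]

theorem cfMat_replicate_one (k : ℕ) : cfMat (List.replicate (2 * k) 1) = vMat ^ k := by
  rw [cfMat, List.map_replicate, List.prod_replicate, pow_mul]
  congr 1
  rw [pow_two]
  ext i j
  fin_cases i <;> fin_cases j <;> simp [vMat, Matrix.mul_apply]

/-- With `C = cfMat [2]` and `C² = hMat * vMat`, a block satisfies `C (C vMat^k C) = (hMat *
vMat^(k+1)) C`. Thus a single `C` moves through all blocks from left to right. -/
theorem cfMat_flatMap (k : ℕ → ℕ) (n : ℕ) :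
    cfMat [2] * cfMat ((List.range n).flatMap fun i => [2] ++ List.replicate (2 * k i) 1 ++ [2]) =
      ((List.range n).map fun i => hMat * vMat ^ (k i + 1)).prod * cfMat [2] := by
  have h2 : hMat * vMat = cfMat [2] * cfMat [2] := by
    rw [cfMat_two]
    ext i j
    fin_cases i <;> fin_cases j <;> simp [hMat, vMat, Matrix.mul_apply, Fin.sum_univ_two]
  generalize List.range n = l
  induction l with
  | nil => simp [cfMat]
  | cons i l ih =>
    rw [List.flatMap_cons, List.map_cons, List.prod_cons, mul_assoc, ← ih, cfMat_append,
      cfMat_append, cfMat_append, cfMat_replicate_one, pow_succ', ← mul_assoc hMat, h2]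
    simp only [mul_assoc]

/-- The definition of `slopeMat` uses the floor `q` at height `p`, whereas `s_p = q - 1`. The last
exponent is therefore one larger than `ν_p`, and the surplus factor is split off. -/
theorem slopeMat_eq {p q : ℕ} (hp : 0 < p) (hpq : p < q) :
    slopeMat q p = ((List.range p).map fun i => hMat * vMat ^ crossing p q (i + 1)).prod * vMat := by
  obtain ⟨n, rfl⟩ : ∃ n, p = n + 1 := ⟨p - 1, by omega⟩
  rw [slopeMat, if_neg (by omega), List.range_succ, List.map_append, List.map_append,
    List.prod_append, List.prod_append, mul_assoc]
  congr 1
  · congr 1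
    apply List.map_congr_left
    intro i hi
    rw [List.mem_range] at hi
    rw [crossing_succ_eq, crossingSum, crossingSum, if_neg (by omega), if_neg (by omega)]
  · rw [List.map_singleton, List.map_singleton, List.prod_singleton, List.prod_singleton, mul_assoc,
      ← pow_succ]
    have h1 := lt_crossingSum_succ hpq (Nat.lt_succ_self n)
    have h2 : crossingSum (n + 1) q (n + 1) = q - 1 := if_pos rfl
    have h3 : crossingSum (n + 1) q n = n * q / (n + 1) := if_neg (by omega)
    rw [h2, h3] at h1
    rw [crossing_succ_eq, h2, h3, Nat.mul_div_cancel_left _ hp]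
    congr 2
    omega

theorem num_markovCF {p q : ℕ} (hp : 0 < p) (hpq : p < q) (h : Nat.Coprime p q) :
    (cfValue (markovCF p q)).num = slopeNumber q p := by
  rw [num_cfValue (by simp [markovCF]) (fun x hx => by have := mem_markovCF hp hx; omega),
    cfPair_eq, slopeNumber_eq h.symm, slopeMat_eq hp hpq, markovCF_eq_flatMap hp]
  have h1 := cfMat_flatMap (fun i => crossing p q (i + 1) - 1) p
  have h2 : ((List.range p).map fun i => hMat * vMat ^ (crossing p q (i + 1) - 1 + 1)) =
      (List.range p).map fun i => hMat * vMat ^ crossing p q (i + 1) := by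
    apply List.map_congr_left
    intro i hi
    rw [Nat.sub_add_cancel (crossing_pos hpq (List.mem_range.1 hi))]
  rw [h2] at h1
  generalize ((List.range p).map fun i => hMat * vMat ^ crossing p q (i + 1)).prod = P at *
  generalize cfMat ((List.range p).flatMap _) = Q at *
  -- The second row `(1, 0)` of `C` extracts the upper left entry of `Q`. On the other side, `C` and
  -- `vMat` share the first column `(2, 1)`, so `P * C` and `P * vMat` have the same lower left
  -- entry.
  have h3 := congrFun (congrFun h1 1) 0
  simp [cfMat_two, vMat, Matrix.mul_apply, Fin.sum_univ_two] at h3 ⊢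
  exact h3

/-! ### Decomposition into maximal runs. -/

/-- A run of `1`s followed by a run of `2`s. -/
def runPair (x : ℕ × ℕ) : List ℕ := List.replicate x.1 1 ++ List.replicate x.2 2

theorem splitBy_replicate_append {a : ℕ} {n : ℕ} (hn : 0 < n) {l : List ℕ} (hl : l.head? ≠ some a) :
    (List.replicate n a ++ l).splitBy (fun x y => x == y) =
      List.replicate n a :: l.splitBy (fun x y => x == y) := by
  rw [List.splitBy_append, List.splitBy_of_isChain]
  · simp
  · simp; omega
  · exact List.isChain_replicate_of_rel _ (by simp)
  · intro x hx y hy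
    have := List.mem_replicate.1 (List.mem_of_mem_getLast? hx)
    rw [this.2]
    simp only [beq_eq_false_iff_ne]
    rintro rfl
    exact hl hy

theorem splitBy_runs (ps : List (ℕ × ℕ)) : ∀ t : ℕ, 0 < t → (∀ x ∈ ps, 0 < x.1 ∧ 0 < x.2) →
    (List.replicate t 2 ++ ps.flatMap runPair).splitBy (fun x y => x == y) =
      List.replicate t 2 :: ps.flatMap fun x => [List.replicate x.1 1, List.replicate x.2 2] := by
  induction ps with
  | nil =>
    intro t ht _
    rw [splitBy_replicate_append ht (by simp)]; simp
  | cons x ps ih =>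
    intro t ht h
    obtain ⟨h1, h2⟩ := h x (by simp)
    obtain ⟨m, hm⟩ : ∃ m, x.1 = m + 1 := ⟨x.1 - 1, by omega⟩
    obtain ⟨n, hn⟩ : ∃ n, x.2 = n + 1 := ⟨x.2 - 1, by omega⟩
    rw [List.flatMap_cons, List.flatMap_cons, runPair, splitBy_replicate_append ht, List.append_assoc,
      splitBy_replicate_append h1, ih _ h2 fun x hx => h x (List.mem_cons_of_mem _ hx)]
    · simp
    · simp [hn, List.replicate_succ]
    · simp [hm, List.replicate_succ]

theorem runLengths_two_runs {ps : List (ℕ × ℕ)} {t : ℕ} (ht : 0 < t)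
    (h : ∀ x ∈ ps, 0 < x.1 ∧ 0 < x.2) :
    runLengths 2 (List.replicate t 2 ++ ps.flatMap runPair) = t :: ps.map Prod.snd := by
  rw [runLengths, splitBy_runs ps t ht h, List.filter_cons_of_pos, List.map_cons,
    List.length_replicate]
  · congr 1
    clear ht
    induction ps with
    | nil => simp
    | cons x ps ih =>
      obtain ⟨h1, h2⟩ := h x (by simp)
      simp [List.head?_replicate, h1.ne', h2.ne', ih fun x hx => h x (List.mem_cons_of_mem _ hx)]
  · simp [List.head?_replicate, ht.ne']

theorem runLengths_one_runs {ps : List (ℕ × ℕ)} {t : ℕ} (ht : 0 < t)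
    (h : ∀ x ∈ ps, 0 < x.1 ∧ 0 < x.2) :
    runLengths 1 (List.replicate t 2 ++ ps.flatMap runPair) = ps.map Prod.fst := by
  rw [runLengths, splitBy_runs ps t ht h, List.filter_cons_of_neg]
  · clear ht
    induction ps with
    | nil => simp
    | cons x ps ih =>
      obtain ⟨h1, h2⟩ := h x (by simp)
      simp [List.head?_replicate, h1.ne', h2.ne', ih fun x hx => h x (List.mem_cons_of_mem _ hx)]
  · simp [List.head?_replicate, ht.ne']

/-- The part `2, 1, …, 1, 2` of a continued fraction, with `2 k` entries `1`. -/
def crossingBlock (k : ℕ) : List ℕ := [2] ++ List.replicate (2 * k) 1 ++ [2]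

/-- The regrouping shifts by one entry: the closing `2` of a block joins the opening `2` of the next
one, the appended `2` serving as the last partner. -/
theorem flatMap_crossingBlock_append (k : ℕ → ℕ) (l : List ℕ) :
    l.flatMap (fun i => crossingBlock (k i)) ++ [2] =
      [2] ++ (l.map fun i => (2 * k i, 2)).flatMap runPair := by
  induction l with
  | nil => simp
  | cons i l ih =>
    rw [List.flatMap_cons, List.append_assoc, ih]
    simp [crossingBlock, runPair]

theorem flatMap_crossingBlock_zero {k : ℕ → ℕ} {s g : ℕ} (h : ∀ i < g, k (s + i) = 0) :
    ((List.range g).map (s + ·)).flatMap (fun i => crossingBlock (k i)) =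
      List.replicate (2 * g) 2 := by
  induction g with
  | zero => simp
  | succ g ih =>
    rw [List.range_succ, List.map_append, List.flatMap_append, ih fun i hi => h i (by omega)]
    simp [crossingBlock, h g (by omega), mul_add, List.replicate_add]

theorem flatMap_crossingBlock_one {k : ℕ → ℕ} {s g : ℕ} (h : ∀ i < g, k (s + i) = 0)
    (h1 : k (s + g) = 1) :
    ((List.range (g + 1)).map (s + ·)).flatMap (fun i => crossingBlock (k i)) =
      List.replicate (2 * (g + 1) - 1) 2 ++ [1, 1, 2] := by
  rw [List.range_succ, List.map_append, List.flatMap_append, flatMap_crossingBlock_zero h,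
    show 2 * (g + 1) - 1 = 2 * g + 1 by omega, List.replicate_add]
  simp [crossingBlock, h1, List.replicate_succ]

/-- The blocks with `k = 1` are those at the zero-based positions `J (m + 1) - 1`, and all others
are just `2, 2`. The first run is one shorter than twice the gap because its last block closes after
the two `1`s; that closing `2` opens the next run. -/
theorem flatMap_crossingBlock_of_jumps {k J : ℕ → ℕ} (n : ℕ) (hJ0 : J 0 = 0)
    (hJ : ∀ m ≤ n, J m < J (m + 1))
    (h0 : ∀ m ≤ n, ∀ i, J m ≤ i → i + 1 < J (m + 1) → k i = 0)
    (h1 : ∀ m ≤ n, ∀ i, i + 1 = J (m + 1) → k i = 1) :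
    (List.range (J (n + 1))).flatMap (fun i => crossingBlock (k i)) =
      List.replicate (2 * J 1 - 1) 2 ++
        ((List.range n).map fun j => (2, 2 * (J (j + 2) - J (j + 1)))).flatMap runPair ++
          [1, 1, 2] := by
  have step : ∀ m ≤ n, ((List.range (J (m + 1) - J m)).map (J m + ·)).flatMap
      (fun i => crossingBlock (k i)) =
        List.replicate (2 * (J (m + 1) - J m) - 1) 2 ++ [1, 1, 2] := by
    intro m hm
    have := hJ m hm
    obtain ⟨g, hg⟩ : ∃ g, J (m + 1) - J m = g + 1 := ⟨J (m + 1) - J m - 1, by omega⟩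
    rw [hg]
    exact flatMap_crossingBlock_one (fun i hi => h0 m hm _ (by omega) (by omega))
      (h1 m hm _ (by omega))
  induction n with
  | zero =>
    have := step 0 le_rfl
    simpa [hJ0] using this
  | succ n ih =>
    have hlt : J (n + 1) < J (n + 2) := hJ (n + 1) le_rfl
    rw [show J (n + 1 + 1) = J (n + 1) + (J (n + 2) - J (n + 1)) from by
        change J (n + 2) = _; omega, List.range_add,
      List.flatMap_append, step (n + 1) le_rfl, ih (fun m hm => hJ m (by omega))
        (fun m hm => h0 m (by omega)) (fun m hm => h1 m (by omega)) (fun m hm => step m (by omega)),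
      List.range_succ, List.map_append, List.flatMap_append]
    obtain ⟨g, hg⟩ : ∃ g, J (n + 2) - J (n + 1) = g + 1 := ⟨J (n + 2) - J (n + 1) - 1, by omega⟩
    simp [runPair, hg, List.replicate_succ, mul_add]

/-! ### Balanced crossing numbers and the lengths of the runs. -/

/-- Consecutive floors of multiples of `q / p` differ by `⌊q/p⌋` or one more. The last crossing
number is lowered by the convention `s_p = q - 1`; by symmetry it equals the first, which is exactly
`⌊q/p⌋`. For `p = 1` the only row is both first and last and has `q - 1` crossings. -/
theorem crossing_bounds {p q i : ℕ} (hp : 2 ≤ p) (hpq : p < q) (h : Nat.Coprime p q) (hi : i < p) :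
    q / p ≤ crossing p q (i + 1) ∧ crossing p q (i + 1) ≤ q / p + 1 := by
  have hp0 : 0 < p := by omega
  have h1 : i * q = p * (i * q / p) + i * q % p := (Nat.div_add_mod _ _).symm
  have h1' := Nat.mod_lt (i * q) hp0
  have h2 : q = p * (q / p) + q % p := (Nat.div_add_mod _ _).symm
  have h2' := Nat.mod_lt q hp0
  have h3 : (i + 1) * q / p ≤ i * q / p + q / p + 1 := by
    apply Nat.le_of_lt_succ
    rw [Nat.div_lt_iff_lt_mul hp0]
    nlinarith
  have h4 : i * q / p + q / p ≤ (i + 1) * q / p := by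
    rw [add_mul, one_mul]
    exact Nat.div_add_div_le_add_div
  have hSi : crossingSum p q i = i * q / p := if_neg hi.ne
  constructor
  · rcases (Nat.succ_le_of_lt hi).eq_or_lt with h5 | h5
    · have h6 := crossing_reflect h hpq hp0
      rw [show p - 1 - 0 + 1 = i + 1 by omega] at h6
      rw [h6, crossing_succ_eq, crossingSum, crossingSum, if_neg (by omega), if_neg (by omega)]
      simp
    · have h6 : crossingSum p q (i + 1) = (i + 1) * q / p := if_neg (show i + 1 ≠ p by omega)
      rw [crossing_succ_eq, h6, hSi]
      exact Nat.le_sub_of_add_le' h4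
  · have := crossingSum_le (q := q) (i := i + 1) hp0
    rw [crossing_succ_eq, hSi, Nat.sub_le_iff_le_add']
    exact this.trans h3

theorem abs_crossing_sub_le {p q i j : ℕ} (hpq : p < q) (h : Nat.Coprime p q) (hi : 1 ≤ i)
    (hip : i ≤ p) (hj : 1 ≤ j) (hjp : j ≤ p) :
    |(crossing p q i : ℤ) - (crossing p q j : ℤ)| ≤ 1 := by
  rcases Nat.lt_or_ge p 2 with hp | hp
  · obtain rfl : i = j := by omega
    simp
  · have h1 := crossing_bounds (i := i - 1) hp hpq h (by omega)
    have h2 := crossing_bounds (i := j - 1) hp hpq h (by omega)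
    rw [Nat.sub_add_cancel hi] at h1
    rw [Nat.sub_add_cancel hj] at h2
    rw [abs_le]
    omega

/-- The structure of the sequence `markovCF p q` in terms of its maximal constant subsequences,
where `c` is the number of `2`s of the first pairs. -/
def HasRuns (p q c : ℕ) : Prop :=
  ∃ (ps : List (ℕ × ℕ)) (o : ℕ),
    markovCF p q = List.replicate (2 * c - 1) 2 ++ (ps ++ [(o, 2 * c - 1)]).flatMap runPair ∧
    (∀ x ∈ ps, 0 < x.1 ∧ 0 < x.2 ∧ (x.2 = 2 * c - 2 ∨ x.2 = 2 * c) ∧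
      ∃ i, 1 ≤ i ∧ i ≤ p ∧ x.1 = 2 * (crossing p q i - 1)) ∧
    (0 < o ∧ ∃ i, 1 ≤ i ∧ i ≤ p ∧ o = 2 * (crossing p q i - 1)) ∧ ps.length + 1 ≤ p

theorem hasRuns_of_two_mul_lt {p q : ℕ} (hp : 0 < p) (h2 : 2 * p < q) (h : Nat.Coprime p q) :
    HasRuns p q 1 := by
  have hcr : ∀ i < p, 2 ≤ crossing p q (i + 1) := by
    intro i hi
    rcases Nat.lt_or_ge p 2 with hp2 | hp2
    · obtain rfl : p = 1 := by omega
      obtain rfl : i = 0 := by omega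
      simp [crossing, crossingSum]
      omega
    · refine le_trans ?_ (crossing_bounds hp2 (by omega) h hi).1
      rw [Nat.le_div_iff_mul_le hp]
      exact h2.le
  obtain ⟨n, rfl⟩ : ∃ n, p = n + 1 := ⟨p - 1, by omega⟩
  refine ⟨(List.range n).map fun i => (2 * (crossing (n + 1) q (i + 1) - 1), 2),
    2 * (crossing (n + 1) q (n + 1) - 1), ?_, ?_, ⟨?_, n + 1, by omega, le_rfl, rfl⟩, by simp⟩
  · have h1 := flatMap_crossingBlock_append (fun i => crossing (n + 1) q (i + 1) - 1) (List.range n)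
    rw [List.flatMap_append, ← List.append_assoc,
      show List.replicate (2 * 1 - 1) 2 = [2] from rfl, ← h1, markovCF_eq_flatMap hp,
      List.range_succ, List.flatMap_append]
    simp [crossingBlock, runPair]
  · intro x hx
    obtain ⟨i, hi, rfl⟩ := List.mem_map.1 hx
    rw [List.mem_range] at hi
    have := hcr i (by omega)
    exact ⟨by simp only; omega, by simp, by simp, i + 1, by omega, by omega, rfl⟩
  · have := hcr n (by omega)
    omega

/-- The position of the `m`-th block with two crossings. -/
def jump (p r m : ℕ) : ℕ := (m * p + (r - 1)) / r

/-- `jump p r m` is the ceiling of `mp/r`, and `s_i - i = ⌊ir/p⌋` for `i < p`. So it is the first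
height at which the excess of `s_i` over one crossing per row reaches `m`. -/
theorem jump_le_iff {p q r m i : ℕ} (hp : 0 < p) (hr : 0 < r) (hq : q = p + r) (hi : i ≤ p)
    (hm : m + 1 ≤ r) : jump p r m ≤ i ↔ m + i ≤ crossingSum p q i := by
  have h1 : jump p r m ≤ i ↔ m * p ≤ i * r := by
    rw [jump, ← Nat.lt_succ_iff, Nat.div_lt_iff_lt_mul hr, Nat.succ_mul]
    omega
  rw [h1]
  rcases hi.eq_or_lt with rfl | hi
  · rw [crossingSum, if_pos rfl]
    constructor
    · intro _; omega
    · intro _; nlinarith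
  · rw [crossingSum, if_neg hi.ne, Nat.le_div_iff_mul_le hp, hq]
    constructor <;> intro _ <;> nlinarith

theorem crossingSum_lt_add {p q r i : ℕ} (hp : 0 < p) (hr : 0 < r) (hq : q = p + r) (hi : i ≤ p) :
    crossingSum p q i < i + r := by
  rcases hi.eq_or_lt with rfl | hi
  · rw [crossingSum, if_pos rfl]; omega
  · rw [crossingSum, if_neg hi.ne, Nat.div_lt_iff_lt_mul hp, hq]
    nlinarith

theorem hasRuns_of_lt_two_mul {p q r e s : ℕ} (hr : 2 ≤ r) (hq : q = p + r) (he : 1 ≤ e)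
    (hs : 0 < s) (hsr : s < r) (hpe : p = r * e + s) : HasRuns p q (e + 1) := by
  have hr0 : 0 < r := by omega
  have hrp : r ≤ p := by nlinarith
  have hp : 0 < p := by omega
  have hpq : p < q := by omega
  have hstep : ∀ m, jump p r (m + 1) = e + (m * p + (r - 1) + s) / r := by
    intro m
    rw [jump, ← Nat.mul_add_div hr0]
    congr 1
    rw [hpe]; ring
  have hJ : ∀ m, jump p r m + e ≤ jump p r (m + 1) ∧ jump p r (m + 1) ≤ jump p r m + e + 1 := by
    intro m
    rw [hstep, jump]
    have h1 : (m * p + (r - 1)) / r ≤ (m * p + (r - 1) + s) / r := Nat.div_le_div_right (by omega)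
    have h2 : (m * p + (r - 1) + s) / r ≤ (m * p + (r - 1)) / r + 1 := by
      rw [← Nat.add_div_right _ hr0]; exact Nat.div_le_div_right (by omega)
    omega
  have hJ0 : jump p r 0 = 0 := by
    rw [jump]; exact Nat.div_eq_of_lt (by omega)
  have hJ1 : jump p r 1 = e + 1 := by
    rw [hstep 0]
    congr 1
    apply Nat.div_eq_of_lt_le <;> omega
  -- The ceiling of `(r-1)p/r = p - p/r` is `p - ⌊p/r⌋ = p - e`.
  have hJr : jump p r (r - 1) + e = p := by
    have : jump p r (r - 1) = r * e + s - e := by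
      rw [jump]
      obtain ⟨f, rfl⟩ : ∃ f, r = f + 1 := ⟨r - 1, by omega⟩
      rw [show (f + 1) * e + s - e = f * e + s by rw [Nat.add_mul]; omega, hpe]
      apply Nat.div_eq_of_lt_le
      · simp; nlinarith
      · simp; nlinarith
    rw [this]
    have : e ≤ r * e := Nat.le_mul_of_pos_left _ hr0
    omega
  have hiff : ∀ m i, i ≤ p → m + 1 ≤ r → (jump p r m ≤ i ↔ m + i ≤ crossingSum p q i) :=
    fun m i hi hm => jump_le_iff hp hr0 hq hi hm
  have hle : ∀ m, m + 1 ≤ r → jump p r m ≤ p := by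
    intro m hm
    rw [hiff m p le_rfl hm, crossingSum, if_pos rfl]
    omega
  have hlt : ∀ i ≤ p, crossingSum p q i < i + r := fun i hi => crossingSum_lt_add hp hr0 hq hi
  have hone : ∀ m, m + 2 ≤ r → ∀ i, i + 1 = jump p r (m + 1) → crossing p q (i + 1) = 2 := by
    intro m hm i hi
    have h1 := hle (m + 1) hm
    have h2 := (hiff (m + 1) (i + 1) (by omega) hm).1 (by omega)
    have h3 := (hiff (m + 1) i (by omega) hm).not.1 (by omega)
    have h4 := (hiff m i (by omega) (by omega)).1 (by have := hJ m; omega)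
    have h5 := hlt (i + 1) (by omega)
    rw [crossing_succ_eq]
    -- The excess cannot reach `m + 2` in this row: the next jump comes at least `e ≥ 1` rows later,
    -- or, when `m + 2 = r`, the total excess stays below `r`.
    rcases Nat.lt_or_ge (m + 2) r with h6 | h6
    · have h8 : jump p r (m + 1) + e ≤ jump p r (m + 2) := (hJ (m + 1)).1
      have h7 := (hiff (m + 2) (i + 1) (by omega) h6).not.1 (by omega)
      omega
    · omega
  -- The final excess is `q - 1 - p = r - 1`, so there are `r - 1` doubly crossed rows, which is the
  -- parameter `n = r - 2`. The `e` rows after the last of them contribute only `2`s.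
  have hflat := flatMap_crossingBlock_of_jumps (k := fun i => crossing p q (i + 1) - 1)
    (J := jump p r) (r - 2) hJ0 (fun m _ => by have := (hJ m).1; omega)
    (by
      intro m hm i hi hi'
      have h1 := hle (m + 1) (by omega)
      have h2 := (hiff m i (by omega) (by omega)).1 hi
      have h3 := (hiff (m + 1) (i + 1) (by omega) (by omega)).not.1 (by omega)
      simp only [crossing_succ_eq]
      omega)
    (fun m hm i hi => by simp only [hone m (by omega) i hi])
  rw [show r - 2 + 1 = r - 1 by omega] at hflat
  have hlast := flatMap_crossingBlock_zero (k := fun i => crossing p q (i + 1) - 1)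
    (s := jump p r (r - 1)) (g := e) (by
      intro i hi
      have h1 := (hiff (r - 1) (jump p r (r - 1) + i) (by omega) (by omega)).1 (by omega)
      have h2 := hlt (jump p r (r - 1) + i + 1) (by omega)
      simp only [crossing_succ_eq]
      omega)
  have hexi : ∃ i, 1 ≤ i ∧ i ≤ p ∧ 2 = 2 * (crossing p q i - 1) := by
    refine ⟨e + 1, by omega, ?_, ?_⟩
    · rw [← hJ1]; exact hle 1 (by omega)
    · rw [hone 0 (by omega) e hJ1.symm]
  refine ⟨(List.range (r - 2)).map fun j => (2, 2 * (jump p r (j + 2) - jump p r (j + 1))), 2,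
    ?_, ?_, ⟨by omega, hexi⟩, by simp; omega⟩
  · rw [markovCF_eq_flatMap hp]
    change (List.range p).flatMap (fun i => crossingBlock (crossing p q (i + 1) - 1)) = _
    have hrange : List.range p =
        List.range (jump p r (r - 1)) ++ (List.range e).map (jump p r (r - 1) + ·) := by
      rw [← List.range_add, hJr]
    rw [hrange, List.flatMap_append, hflat, hlast, hJ1, List.flatMap_append]
    simp [runPair, List.replicate_succ, show 2 * (e + 1) - 1 = 2 * e + 1 by omega]
  · intro x hx
    obtain ⟨j, hj, rfl⟩ := List.mem_map.1 hx
    have := hJ (j + 1)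
    rw [show j + 1 + 1 = j + 2 from rfl] at this
    exact ⟨by simp, by simp only; omega, by simp only; omega, hexi⟩

theorem exists_hasRuns {p q : ℕ} (hp : 0 < p) (hpq : p + 1 < q) (h : Nat.Coprime p q) :
    ∃ c, 0 < c ∧ (c - 1) * q < p * c ∧ p * (c + 1) < c * q ∧ HasRuns p q c := by
  obtain ⟨r, rfl⟩ := Nat.exists_eq_add_of_le (show p ≤ q by omega)
  have hr : 2 ≤ r := by omega
  have hpr : Nat.Coprime p r := by simpa using h
  have hs : 0 < p % r := by
    refine Nat.pos_of_ne_zero fun h0 => ?_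
    have := Nat.Coprime.eq_one_of_dvd hpr.symm (Nat.dvd_of_mod_eq_zero h0)
    omega
  have hsr : p % r < r := Nat.mod_lt _ (by omega)
  have hdiv : p = r * (p / r) + p % r := (Nat.div_add_mod _ _).symm
  generalize p / r = e at *
  generalize p % r = s at *
  -- Both slope bounds together say `c - 1 < p/r < c` with `r = q - p`, so `c = ⌊p/r⌋ + 1`. They are
  -- strict because `r ≥ 2` is coprime to `p`. The case `e = 0` is `2p < q`.
  refine ⟨e + 1, by omega, ?_, ?_, ?_⟩
  · rw [Nat.add_sub_cancel]; nlinarith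
  · nlinarith
  · rcases Nat.eq_zero_or_pos e with rfl | he
    · exact hasRuns_of_two_mul_lt hp (by omega) h
    · exact hasRuns_of_lt_two_mul hr rfl he hs hsr hdiv

theorem slope_bounds_iff {p q c : ℕ} (hq : 0 < q) (hc : 0 < c) :
    (((c : ℚ) - 1) / c < (p : ℚ) / q ↔ (c - 1) * q < p * c) ∧
      ((p : ℚ) / q < (c : ℚ) / (c + 1) ↔ p * (c + 1) < c * q) := by
  obtain ⟨e, rfl⟩ : ∃ e, c = e + 1 := ⟨c - 1, by omega⟩
  constructor
  · rw [div_lt_div_iff₀ (by positivity) (by positivity)]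
    push_cast
    rw [add_sub_cancel_right]
    exact_mod_cast Iff.rfl
  · rw [div_lt_div_iff₀ (by positivity) (by positivity)]
    exact_mod_cast Iff.rfl

/-- The intervals from `(c-1)/c` to `c/(c+1)` are consecutive: if `c' < c` then `c'/(c'+1) ≤
(c-1)/c`. -/
theorem slope_bounds_unique {p q c c' : ℕ} (hpq : p < q) (hc : 0 < c)
    (h1 : (c - 1) * q < p * c) (h2 : p * (c' + 1) < c' * q) : c ≤ c' := by
  by_contra! hlt
  obtain ⟨e, rfl⟩ := Nat.exists_eq_add_of_lt hlt
  rw [show c' + e + 1 - 1 = c' + e by omega] at h1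
  nlinarith

theorem theorem4p1 :
    -- for every slope `p / q`
    (∀ p q : ℕ, 0 < p → p < q → Nat.Coprime p q →
      -- the number `m = m_{p/q}` is well defined, and it is a Markov number
      ∃ m : ℕ, (∀ m' : ℕ, IsMarkovNumberOfSlope p q m' ↔ m' = m) ∧ IsMarkovNumber m ∧
        -- it is the numerator of the continued fraction
        (cfValue (markovCF p q)).num = (m : ℤ) ∧
        -- which is palindromic of even length, with entries `1` and `2`
        (∃ a : List ℕ, markovCF p q = a.reverse ++ a ∧
          (∀ x ∈ a, x = 1 ∨ x = 2) ∧ a.getLast? = some 2 ∧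
          (p + 1 = q → a.length = p ∧ ∀ x ∈ a, x = 2)) ∧
        -- the subsequences of `2`s and of `1`s
        (p + 1 < q → ∃ c : ℕ, 0 < c ∧
          ((c : ℚ) - 1) / c < (p : ℚ) / q ∧ (p : ℚ) / q < (c : ℚ) / (c + 1) ∧
          (∀ c' : ℕ, 0 < c' → ((c' : ℚ) - 1) / c' < (p : ℚ) / q →
            (p : ℚ) / q < (c' : ℚ) / (c' + 1) → c' = c) ∧
          ((runLengths 2 (markovCF p q)).length ≤ p + 1 ∧
            ∃ mid : List ℕ,
              runLengths 2 (markovCF p q) = [2 * c - 1] ++ mid ++ [2 * c - 1] ∧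
              ∀ l ∈ mid, l = 2 * c - 2 ∨ l = 2 * c) ∧
          ((runLengths 1 (markovCF p q)).length ≤ p ∧
            (∀ l ∈ runLengths 1 (markovCF p q),
              ∃ i : ℕ, 1 ≤ i ∧ i ≤ p ∧ l = 2 * (crossing p q i - 1)) ∧
            ∀ i j : ℕ, 1 ≤ i → i ≤ p → 1 ≤ j → j ≤ p →
              |(crossing p q i : ℤ) - (crossing p q j : ℤ)| ≤ 1))) ∧
    -- every Markov number other than `1` and `2` is of the form `m_{p/q}`
    (∀ m : ℕ, IsMarkovNumber m → m ≠ 1 → m ≠ 2 →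
      ∃ p q : ℕ, 0 < p ∧ p < q ∧ Nat.Coprime p q ∧ IsMarkovNumberOfSlope p q m) ∧
    -- the map from rational numbers between `0` and `1` to continued fractions is injective
    Set.InjOn (fun r : ℚ => markovCF r.num.toNat r.den) (Set.Ioo (0 : ℚ) 1) := by
  refine ⟨?_, ?_, injOn_markovCF⟩
  · intro p q hp hpq h
    obtain ⟨m, hm, hM⟩ := exists_markovNumber_eq_slopeNumber hp hpq h
    refine ⟨m, ?_, hM, by rw [hm, num_markovCF hp hpq h], exists_half_markovCF hp hpq h, ?_⟩
    · intro m'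
      rw [isMarkovNumberOfSlope_iff hp hpq h, ← hm]
      exact Nat.cast_inj
    · intro hpq1
      obtain ⟨c, hc, h1, h2, ps, o, hF, hps, ⟨ho, ho'⟩, hlen⟩ := exists_hasRuns hp hpq1 h
      have hpos : ∀ x ∈ ps ++ [(o, 2 * c - 1)], 0 < x.1 ∧ 0 < x.2 := by
        intro x hx
        rcases List.mem_append.1 hx with hx | hx
        · exact ⟨(hps x hx).1, (hps x hx).2.1⟩
        · rw [List.mem_singleton.1 hx]
          exact ⟨ho, by simp only; omega⟩
      have hr2 := runLengths_two_runs (t := 2 * c - 1) (by omega) hpos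
      have hr1 := runLengths_one_runs (t := 2 * c - 1) (by omega) hpos
      rw [← hF] at hr1 hr2
      have hq : 0 < q := by omega
      refine ⟨c, hc, (slope_bounds_iff hq hc).1.2 h1, (slope_bounds_iff hq hc).2.2 h2, ?_,
        ⟨?_, ps.map Prod.snd, ?_, ?_⟩, ?_, ?_,
        fun i j hi hip hj hjp => abs_crossing_sub_le hpq h hi hip hj hjp⟩
      · intro c' hc' h1' h2'
        rw [(slope_bounds_iff hq hc').1] at h1'
        rw [(slope_bounds_iff hq hc').2] at h2'
        exact le_antisymm (slope_bounds_unique hpq hc' h1' h2)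
          (slope_bounds_unique hpq hc h1 h2')
      · rw [hr2]; simp; omega
      · rw [hr2]; simp
      · intro l hl
        obtain ⟨x, hx, rfl⟩ := List.mem_map.1 hl
        exact (hps x hx).2.2.1
      · rw [hr1]; simp; omega
      · intro l hl
        rw [hr1] at hl
        obtain ⟨x, hx, rfl⟩ := List.mem_map.1 hl
        rcases List.mem_append.1 hx with hx | hx
        · exact (hps x hx).2.2.2
        · rw [List.mem_singleton.1 hx]
          exact ho'
  · intro m hm h1 h2
    rcases isSlopeNumber_of_isMarkovNumber hm with h | h | ⟨p, q, hp, hpq, hc, h⟩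
    · exact absurd h h1
    · exact absurd h h2
    · exact ⟨p, q, hp, hpq, hc, (isMarkovNumberOfSlope_iff hp hpq hc m).2 h⟩
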